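/- For a quadratic field $K$ (a number field of degree $2$ over $\mathbb{Q}$) say that $\mathbb{Z}/14\mathbb{Z}$ appears as a torsion group over $K$ if there is an elliptic curve $E$ over $K$ whose torsion subgroup $E(K)_{\mathrm{tors}}$ is isomorphic to $\mathbb{Z}/14\mathbb{Z}$. Let $\Delta_K$ denote the discriminant of $K$. Then the quadratic field with smallest $|\Delta_K|$ such that $\mathbb{Z}/14\mathbb{Z}$ appears as a torsion group over it is $\mathbb{Q}(\sqrt{-7})$: among the quadratic fields over which $\mathbb{Z}/14\mathbb{Z}$ appears as a torsion group, the minimum of $|\Delta_K|$ is attained at $K\cong\mathbb{Q}(\sqrt{-7})$ and, up to isomorphism, at no other field. -/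

import Mathlib

open scoped IntermediateField

/-- `A` appears as a torsion group over the field `K`: there is an elliptic curve `E` over `K`
(given by a Weierstrass equation with nonzero discriminant) such that the torsion subgroup of
`E(K)` is isomorphic to `A`. -/
def AppearsAsTorsionGroup (A : Type) [AddCommGroup A] (K : Type*) [Field K] : Prop :=
  open Classical in
  ∃ (E : WeierstrassCurve K) (_ : E.IsElliptic),
    Nonempty (AddCommGroup.torsion E.toAffine.Point ≃+ A)

/-- `K` is a quadratic field of smallest `|Δ|` such that `A` appears as a torsion group over it. -/
def IsSmallestQuadraticFieldWithTorsion.{u} (A : Type) [AddCommGroup A]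
    (K : Type u) [Field K] [NumberField K] : Prop :=
  Algebra.IsQuadraticExtension ℚ K ∧ AppearsAsTorsionGroup A K ∧
    ∀ (L : Type u) [Field L] [NumberField L], Algebra.IsQuadraticExtension ℚ L →
      AppearsAsTorsionGroup A L → |NumberField.discr K| ≤ |NumberField.discr L|

/-- The quadratic field `ℚ(√-7)`, as a subfield of `ℂ`. -/
abbrev QSqrtNegSeven : Type := ℚ⟮Complex.I * (Real.sqrt 7 : ℂ)⟯

/-! A point of order 14 on an elliptic curve over `K` gives a non-cuspidal `K`-point of the modular
curve X₁(14), which is the elliptic curve y² = x³ - 11x² + 32x; its points with x = 0, 4, 8 are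
cusps (`exists_point_of_addOrderOf_eq`). Discriminants of quadratic fields are non-squares congruent
to 0 or 1 modulo 4, so those of absolute value at most 7 are -3, -4, 5 and -7. It remains to exclude
ℚ(√-3), ℚ(i), ℚ(√5), and to exhibit a curve over ℚ(√-7).

Exclusion: with σ the conjugation of K = ℚ(√D), a point P of X₁(14) over K yields the rational point
P + σP and the anti-invariant point P - σP, which lives on the quadratic twist by D. For D = 1, -1,
-3, 5 a descent via 2-isogeny shows that every rational point of the twist is, up to (0, 0), a
double; with heights this forces all points to be torsion (`isOfFinAddOrder_of_twist`). Torsion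
injects into the points modulo a prime of good reduction (`card_torsion_le`), so X₁(14) has six
rational points, all cusps, and the twists by -1, -3, 5 have two each. A 4-torsion argument then
shows that every K-point is a cusp (`x_eq_of_quadratic_field`).

Existence: `curve14` carries a point of order 7 besides (0, 0). Since -7 is a square in ℚ₁₁, the
field embeds in ℚ₁₁, and counting points modulo 11 bounds the torsion by 14
(`nonempty_torsion_curve14_equiv`). -/

namespace WeierstrassCurve

/-! ### Curves with a rational point of order two at the origin. -/

/-- A Weierstrass equation of the form `y² = x³ + a₂ x² + a₄ x`. -/
class IsTwoTorsionNF {R : Type*} [CommRing R] (W : WeierstrassCurve R) : Prop where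
  a₁ : W.a₁ = 0
  a₃ : W.a₃ = 0
  a₆ : W.a₆ = 0

instance {R S : Type*} [CommRing R] [CommRing S] (W : WeierstrassCurve R) [h : IsTwoTorsionNF W]
    (f : R →+* S) : IsTwoTorsionNF (W.map f) :=
  ⟨by simp [h.a₁], by simp [h.a₃], by simp [h.a₆]⟩

namespace Affine

open IsTwoTorsionNF

section CommRing

variable {R : Type*} [CommRing R] {W : Affine R} [hW : IsTwoTorsionNF W]

lemma equation_iff_of_isTwoTorsionNF {x y : R} :
    W.Equation x y ↔ y ^ 2 = x ^ 3 + W.a₂ * x ^ 2 + W.a₄ * x := by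
  rw [equation_iff, hW.a₁, hW.a₃, hW.a₆]; simp

lemma negY_of_isTwoTorsionNF (x y : R) : W.negY x y = -y := by
  simp [negY, hW.a₁, hW.a₃]

lemma Δ_of_isTwoTorsionNF : W.Δ = 16 * W.a₄ ^ 2 * (W.a₂ ^ 2 - 4 * W.a₄) := by
  simp only [Δ, b₂, b₄, b₆, b₈, hW.a₁, hW.a₃, hW.a₆]; ring

end CommRing

section Field

variable {F : Type*} [Field F] {W : Affine F} [hW : IsTwoTorsionNF W]

lemma Point.X_eq_iff_of_isTwoTorsionNF {x y₁ y₂ : F} (h₁ : W.Nonsingular x y₁)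
    (h₂ : W.Nonsingular x y₂) : y₁ = y₂ ∨ y₁ = -y₂ := by
  have e₁ := equation_iff_of_isTwoTorsionNF.mp h₁.1
  have e₂ := equation_iff_of_isTwoTorsionNF.mp h₂.1
  exact sq_eq_sq_iff_eq_or_eq_neg.mp (e₁.trans e₂.symm)

lemma Point.neg_some_of_isTwoTorsionNF {x y : F} (h : W.Nonsingular x y) :
    ∃ h', -some x y h = some x (-y) h' := by
  have := neg_some h
  rw [this]
  simp only [some.injEq, true_and]
  exact ⟨negY_of_isTwoTorsionNF (W := W) x y ▸ (W.nonsingular_neg x y).mpr h,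
    negY_of_isTwoTorsionNF x y⟩

section IsElliptic

variable [W.IsElliptic]

lemma a₄_ne_zero_of_isTwoTorsionNF : W.a₄ ≠ 0 := by
  intro h
  apply W.isUnit_Δ.ne_zero
  rw [Δ_of_isTwoTorsionNF, h]; ring

lemma two_ne_zero_of_isTwoTorsionNF (W : Affine F) [IsTwoTorsionNF W] [W.IsElliptic] :
    (2 : F) ≠ 0 := by
  intro h
  apply (WeierstrassCurve.isUnit_Δ W).ne_zero
  rw [Δ_of_isTwoTorsionNF]; linear_combination (8 * W.a₄ ^ 2 * (W.a₂ ^ 2 - 4 * W.a₄)) * h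

lemma nonsingular_iff_of_isTwoTorsionNF {x y : F} :
    W.Nonsingular x y ↔ y ^ 2 = x ^ 3 + W.a₂ * x ^ 2 + W.a₄ * x := by
  rw [← equation_iff_nonsingular, equation_iff_of_isTwoTorsionNF]

variable (W) in
/-- The point `(0, 0)` of order two. -/
def twoTorsionPoint : W.Point :=
  .some 0 0 (nonsingular_iff_of_isTwoTorsionNF.mpr (by ring))

lemma twoTorsionPoint_ne_zero : twoTorsionPoint W ≠ 0 := Point.some_ne_zero _

end IsElliptic

end Field

section Group

variable {F : Type*} [Field F] [DecidableEq F] {W : Affine F}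

/-- Three points of a Weierstrass curve with sum zero lie on a line, and their `x`-coordinates are
the roots of the corresponding cubic. -/
lemma Point.exists_line {x₁ y₁ x₂ y₂ x₃ y₃ : F} {h₁ : W.Nonsingular x₁ y₁}
    {h₂ : W.Nonsingular x₂ y₂} {h₃ : W.Nonsingular x₃ y₃}
    (h : some x₁ y₁ h₁ + some x₂ y₂ h₂ = some x₃ y₃ h₃) :
    ∃ ℓ m : F, y₁ = ℓ * x₁ + m ∧ y₂ = ℓ * x₂ + m ∧ W.negY x₃ y₃ = ℓ * x₃ + m ∧
      ∀ t, (t - x₁) * (t - x₂) * (t - x₃) = t ^ 3 + W.a₂ * t ^ 2 + W.a₄ * t + W.a₆ -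
        (ℓ * t + m) ^ 2 - (W.a₁ * t + W.a₃) * (ℓ * t + m) := by
  have hxy : ¬(x₁ = x₂ ∧ y₁ = W.negY x₂ y₂) := by
    intro hxy
    rw [add_of_Y_eq hxy.1 hxy.2] at h
    exact absurd h.symm (some_ne_zero _)
  rw [add_some hxy, some.injEq] at h
  obtain ⟨hx₃, hy₃⟩ := h
  set ℓ := W.slope x₁ x₂ y₁ y₂ with hℓ
  have key := addPolynomial_slope h₁.1 h₂.1 hxy
  rw [← hℓ, hx₃] at key
  refine ⟨ℓ, y₁ - ℓ * x₁, by ring, ?_, ?_, fun t ↦ ?_⟩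
  · by_cases hx : x₁ = x₂
    · have := Y_eq_of_Y_ne h₁.1 h₂.1 hx fun h ↦ hxy ⟨hx, h⟩
      rw [hx, this]; ring
    · rw [hℓ, slope_of_X_ne hx]
      have : x₁ - x₂ ≠ 0 := sub_ne_zero.mpr hx
      field_simp
      ring
  · rw [← hy₃, addY, hx₃, negY_negY, negAddY, hx₃]; ring
  · have := congr_arg (Polynomial.eval t) key
    simp only [addPolynomial_eq, Cubic.toPoly, Polynomial.eval_neg, Polynomial.eval_mul,
      Polynomial.eval_add, Polynomial.eval_sub, Polynomial.eval_C, Polynomial.eval_pow,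
      Polynomial.eval_X] at this
    linear_combination this

variable [hW : IsTwoTorsionNF W]

lemma Point.exists_add_of_X_ne {x₁ y₁ x₂ y₂ : F} (h₁ : W.Nonsingular x₁ y₁)
    (h₂ : W.Nonsingular x₂ y₂) (hx : x₁ ≠ x₂) :
    ∃ x y h, some x₁ y₁ h₁ + some x₂ y₂ h₂ = some x y h ∧
      x = ((y₁ - y₂) / (x₁ - x₂)) ^ 2 - W.a₂ - x₁ - x₂ := by
  refine ⟨_, _, _, add_of_X_ne hx, ?_⟩
  rw [addX, slope_of_X_ne hx, hW.a₁]; ring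

lemma Point.exists_sub_of_X_ne {x₁ y₁ x₂ y₂ : F} (h₁ : W.Nonsingular x₁ y₁)
    (h₂ : W.Nonsingular x₂ y₂) (hx : x₁ ≠ x₂) :
    ∃ x y h, some x₁ y₁ h₁ - some x₂ y₂ h₂ = some x y h ∧
      x = ((y₁ + y₂) / (x₁ - x₂)) ^ 2 - W.a₂ - x₁ - x₂ := by
  obtain ⟨h', e⟩ := neg_some_of_isTwoTorsionNF h₂
  obtain ⟨x, y, h, e', hx⟩ := exists_add_of_X_ne h₁ h' hx
  exact ⟨x, y, h, by rw [sub_eq_add_neg, e, e'], by rw [hx, sub_neg_eq_add]⟩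

/-- That the `x`-coordinate of a double is a square is what drives the halving, the 4-torsion and
the reduction arguments below. -/
lemma Point.exists_add_self {x y : F} (h : W.Nonsingular x y) (hy : 2 * y ≠ 0) :
    ∃ x' y' h', some x y h + some x y h = some x' y' h' ∧
      x' = ((x ^ 2 - W.a₄) / (2 * y)) ^ 2 := by
  have hne : y ≠ W.negY x y := by
    rw [negY_of_isTwoTorsionNF]; intro h; apply hy; linear_combination h
  refine ⟨_, _, _, add_self_of_Y_ne hne, ?_⟩
  have h0 := equation_iff_of_isTwoTorsionNF.mp h.1
  rw [addX, slope_of_Y_ne rfl hne, negY_of_isTwoTorsionNF, hW.a₁, sub_neg_eq_add, ← two_mul]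
  have e₁ := div_mul_cancel₀ (3 * x ^ 2 + 2 * W.a₂ * x + W.a₄ - 0 * y) hy
  have e₂ := div_mul_cancel₀ (x ^ 2 - W.a₄) hy
  set ℓ := (3 * x ^ 2 + 2 * W.a₂ * x + W.a₄ - 0 * y) / (2 * y)
  set z := (x ^ 2 - W.a₄) / (2 * y)
  refine mul_right_cancel₀ (pow_ne_zero 2 hy) ?_
  linear_combination (ℓ * (2 * y) + (3 * x ^ 2 + 2 * W.a₂ * x + W.a₄)) * e₁ -
    (z * (2 * y) + (x ^ 2 - W.a₄)) * e₂ - 4 * (W.a₂ + 2 * x) * h0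

lemma Point.add_self_eq_zero {x y : F} (h : W.Nonsingular x y) (hy : 2 * y = 0) :
    some x y h + some x y h = 0 := by
  apply add_self_of_Y_eq
  rw [negY_of_isTwoTorsionNF]; linear_combination hy

section IsElliptic

variable [W.IsElliptic]

lemma twoTorsionPoint_add_self : twoTorsionPoint W + twoTorsionPoint W = 0 :=
  Point.add_self_eq_zero _ (by ring)

/-- The line through the point and the origin meets the curve where the product of the two nonzero
`x`-coordinates is `W.a₄`. -/
lemma exists_add_twoTorsionPoint {x y : F} (h : W.Nonsingular x y) (hx : x ≠ 0) :
    ∃ x' y' h', .some x y h + twoTorsionPoint W = .some x' y' h' ∧ x' = W.a₄ / x := by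
  obtain ⟨x', y', h', e, hx'⟩ := Point.exists_add_of_X_ne h
    (nonsingular_iff_of_isTwoTorsionNF (W := W) (x := 0) (y := 0) |>.mpr (by ring)) hx
  have h0 := equation_iff_of_isTwoTorsionNF.mp h.1
  refine ⟨x', y', h', e, ?_⟩
  rw [hx', sub_zero, sub_zero, div_pow, h0]
  field_simp
  ring

end IsElliptic

end Group

end Affine

end WeierstrassCurve

/-! ### Integrality and residues at a prime, through an embedding into ℚ_p. -/

section PadicIntegers

variable {F : Type*} [Field F] {p : ℕ} [Fact p.Prime] (f : F →+* ℚ_[p])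

/-- The elements of `F` that become `p`-adic integers under `f`. -/
noncomputable def padicIntegers : Subring F := (PadicInt.subring p).comap f

lemma mem_padicIntegers {z : F} : z ∈ padicIntegers f ↔ ‖f z‖ ≤ 1 := Iff.rfl

/-- The reduction map modulo `p` on the elements that become `p`-adic integers under `f`. -/
noncomputable def padicResidue : padicIntegers f →+* ZMod p :=
  PadicInt.toZMod.comp
    { toFun := fun z ↦ (⟨f z, (mem_padicIntegers f).mp z.2⟩ : ℤ_[p])
      map_one' := Subtype.ext (map_one f)
      map_zero' := Subtype.ext (map_zero f)
      map_add' := fun x y ↦ Subtype.ext (map_add f (x : F) (y : F))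
      map_mul' := fun x y ↦ Subtype.ext (map_mul f (x : F) (y : F)) }

lemma padicResidue_eq_zero_iff {z : padicIntegers f} : padicResidue f z = 0 ↔ ‖f z‖ < 1 := by
  have h (x : ℤ_[p]) : PadicInt.toZMod x = 0 ↔ ‖x‖ < 1 := by
    rw [← RingHom.mem_ker, PadicInt.ker_toZMod, IsLocalRing.mem_maximalIdeal, PadicInt.mem_nonunits]
  exact h ⟨f z, (mem_padicIntegers f).mp z.2⟩

lemma padicResidue_ne_zero_iff {z : padicIntegers f} : padicResidue f z ≠ 0 ↔ ‖f z‖ = 1 := by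
  rw [ne_eq, padicResidue_eq_zero_iff, not_lt]
  exact ⟨fun h ↦ le_antisymm z.2 h, fun h ↦ h.ge⟩

lemma norm_map_one_add {e : F} (he : ‖f e‖ < 1) : ‖f (1 + e)‖ = 1 := by
  rw [map_add, map_one, Padic.add_eq_max_of_ne (by simpa using he.ne'), norm_one,
    max_eq_left he.le]

lemma norm_map_one_sub {e : F} (he : ‖f e‖ < 1) : ‖f (1 - e)‖ = 1 := by
  rw [sub_eq_add_neg]; exact norm_map_one_add f (by simpa using he)

lemma mul_self_norm_lt_of_mem {e : F} {z : F} (he : ‖f e‖ < 1) (hz : z ∈ padicIntegers f) :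
    ‖f (e * z)‖ < 1 := by
  rw [map_mul, norm_mul]
  exact lt_of_le_of_lt (mul_le_of_le_one_right (norm_nonneg _) hz) he

/-- If z had norm at least 1, then z² would dominate both S z and Q. This transfers smallness from a
sum and a product to the individual terms. -/
lemma norm_map_lt_of_root {z S Q : F} (h : z ^ 2 - S * z + Q = 0) (hS : ‖f S‖ < 1)
    (hQ : ‖f Q‖ < 1) : ‖f z‖ < 1 := by
  by_contra! hz
  have h1 : f z ^ 2 = f (S * z) + f (-Q) := by
    rw [← map_add, ← map_pow]; congr 1; linear_combination h
  have h2 := Padic.nonarchimedean (f (S * z)) (f (-Q))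
  rw [← h1, norm_pow, map_mul, norm_mul, map_neg, norm_neg] at h2
  rcases le_max_iff.mp h2 with h3 | h3 <;> nlinarith

end PadicIntegers

/-! ### The kernel of reduction, through the even function 1/x. -/

namespace WeierstrassCurve.Affine

open IsTwoTorsionNF

/-- The inverse of the `x`-coordinate, which vanishes at infinity. -/
def Point.invX {F : Type*} [Field F] {W : Affine F} : W.Point → F
  | .zero => 0
  | .some x _ _ => x⁻¹

section Kernel

variable {F : Type*} [Field F] {p : ℕ} [Fact p.Prime] (f : F →+* ℚ_[p])
  {W : Affine F}

/-- The kernel of reduction modulo `p`. -/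
def Point.InKernel : W.Point → Prop
  | .zero => True
  | .some x _ _ => 1 < ‖f x‖

variable {f}

lemma Point.InKernel.norm_invX_lt {P : W.Point} (hP : P.InKernel f) : ‖f P.invX‖ < 1 := by
  cases P with
  | zero => simp [invX]
  | some x y h =>
    have h : 1 < ‖f x‖ := hP
    simpa [invX] using inv_lt_one_of_one_lt₀ h

lemma Point.InKernel.invX_ne_zero {P : W.Point} (hP : P.InKernel f) (h0 : P ≠ 0) :
    P.invX ≠ 0 := by
  cases P with
  | zero => exact absurd rfl h0
  | some x y h =>
    have h : 1 < ‖f x‖ := hP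
    refine inv_ne_zero fun h0 ↦ ?_
    rw [h0] at h; simp at h; linarith

variable [hW : IsTwoTorsionNF W]

lemma Point.InKernel.neg {P : W.Point} (hP : P.InKernel f) : (-P).InKernel f := by
  cases P with
  | zero => exact hP
  | some x y h =>
    obtain ⟨h', e⟩ := neg_some_of_isTwoTorsionNF h
    rw [e]; exact hP

lemma Point.invX_neg (P : W.Point) : (-P).invX = P.invX := by
  cases P with
  | zero => rfl
  | some x y h =>
    obtain ⟨h', e⟩ := neg_some_of_isTwoTorsionNF h
    rw [e]; rfl

/-- The term x³ dominates the right-hand side of the equation when x is not integral. -/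
lemma norm_sq_eq_norm_pow_three {x y : F} (ha : W.a₂ ∈ padicIntegers f)
    (hb : W.a₄ ∈ padicIntegers f) (h : W.Equation x y) (hx : 1 < ‖f x‖) :
    ‖f y‖ ^ 2 = ‖f x‖ ^ 3 := by
  have hx0 : x ≠ 0 := fun h ↦ by rw [h] at hx; simp at hx; linarith
  have hs : ‖f x⁻¹‖ < 1 := by rw [map_inv₀, norm_inv]; exact inv_lt_one_of_one_lt₀ hx
  have e : y ^ 2 = x ^ 3 * (1 + x⁻¹ * (W.a₂ + x⁻¹ * W.a₄)) := by
    rw [equation_iff_of_isTwoTorsionNF.mp h]; field_simp; ring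
  have := congr_arg (fun z ↦ ‖f z‖) e
  rw [map_mul, norm_mul, norm_map_one_add, map_pow, map_pow, norm_pow, norm_pow, mul_one] at this
  · exact this
  · exact mul_self_norm_lt_of_mem f hs (add_mem ha (mul_mem hs.le hb))

/-- From 2 v(y) = 3 v(x) the valuation of x is even, so a negative one is at most -2. This extra
factor of p decides the case of p-torsion. -/
lemma norm_inv_lt_inv {x y : F} (ha : W.a₂ ∈ padicIntegers f)
    (hb : W.a₄ ∈ padicIntegers f) (h : W.Equation x y) (hx : 1 < ‖f x‖) :
    ‖f x⁻¹‖ < (p : ℝ)⁻¹ := by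
  have e := norm_sq_eq_norm_pow_three ha hb h hx
  have hx0 : f x ≠ 0 := fun h ↦ by rw [h] at hx; simp at hx; linarith
  have hy0 : f y ≠ 0 := by
    intro h; have := pow_pos (by linarith : 0 < ‖f x‖) 3; simp [h] at e; linarith
  have hp : 1 < (p : ℝ) := by exact_mod_cast (Fact.out : p.Prime).one_lt
  rw [map_inv₀, norm_inv]
  apply inv_strictAnti₀ (by linarith)
  rw [Padic.norm_eq_zpow_neg_valuation hx0, Padic.norm_eq_zpow_neg_valuation hy0,
    ← zpow_natCast, ← zpow_natCast, ← zpow_mul, ← zpow_mul] at e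
  have e' := zpow_right_injective₀ (by linarith) hp.ne' e
  rw [Padic.norm_eq_zpow_neg_valuation hx0] at hx ⊢
  have h1 : 0 < -(f x).valuation := by
    by_contra! h0
    exact absurd hx (not_lt.mpr (zpow_le_one_of_nonpos₀ hp.le h0))
  calc (p : ℝ) = (p : ℝ) ^ (1 : ℤ) := by simp
    _ < _ := zpow_lt_zpow_right₀ hp (by push_cast at e'; omega)

variable [DecidableEq F]

lemma Point.InKernel.double (hp : p ≠ 2) (ha : W.a₂ ∈ padicIntegers f)
    (hb : W.a₄ ∈ padicIntegers f) {P : W.Point} (hP : P.InKernel f) :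
    (P + P).InKernel f ∧ (1 - W.a₄ * P.invX * P.invX) ^ 2 * (P + P).invX =
      2 * (P.invX + P.invX + 2 * W.a₂ * P.invX * P.invX +
        W.a₄ * P.invX * P.invX * (P.invX + P.invX)) := by
  cases P with
  | zero =>
    refine ⟨trivial, ?_⟩
    change _ * (0 : F) = 2 * ((0 : F) + 0 + 2 * W.a₂ * 0 * 0 + _ * 0 * 0 * (0 + 0))
    ring
  | some x y h =>
    have hx : 1 < ‖f x‖ := hP
    have e := norm_sq_eq_norm_pow_three ha hb h.1 hx
    have hE := equation_iff_of_isTwoTorsionNF.mp h.1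
    have h2 : ‖f 2‖ = 1 := by
      rw [map_ofNat]
      have := Padic.norm_natCast_eq_one_iff (p := p) (n := 2)
      rw [Nat.cast_ofNat] at this
      exact this.mpr ((Nat.coprime_primes Fact.out Nat.prime_two).mpr hp)
    have h20 : (2 : F) ≠ 0 := fun h ↦ by rw [h] at h2; simp at h2
    have hx0 : x ≠ 0 := fun h ↦ by rw [h] at hx; simp at hx; linarith
    have hy0 : y ≠ 0 := fun h ↦ by
      have := pow_pos (by linarith : 0 < ‖f x‖) 3; simp [h] at e; linarith
    obtain ⟨x', y', h', e', hx'⟩ := exists_add_self h (mul_ne_zero h20 hy0)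
    rw [e']
    have hn : ‖f (x ^ 2 - W.a₄)‖ = ‖f x‖ ^ 2 := by
      have : x ^ 2 - W.a₄ = x ^ 2 * (1 - x⁻¹ * (x⁻¹ * W.a₄)) := by field_simp
      have hs : ‖f x⁻¹‖ < 1 := by rw [map_inv₀, norm_inv]; exact inv_lt_one_of_one_lt₀ hx
      rw [this, map_mul, norm_mul, norm_map_one_sub, map_pow, norm_pow, mul_one]
      exact mul_self_norm_lt_of_mem f hs (mul_mem hs.le hb)
    have hx4 : x ^ 2 - W.a₄ ≠ 0 := fun h ↦ by
      have := pow_pos (by linarith : 0 < ‖f x‖) 2; simp [h] at hn; linarith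
    constructor
    · change 1 < ‖f x'‖
      rw [hx', map_pow, map_div₀, map_mul, norm_pow, norm_div, norm_mul, h2, hn, one_mul, div_pow,
        e, one_lt_div (by positivity), ← pow_mul]
      exact pow_lt_pow_right₀ hx (by norm_num)
    · change _ * x'⁻¹ = 2 * (x⁻¹ + x⁻¹ + 2 * W.a₂ * x⁻¹ * x⁻¹ + W.a₄ * x⁻¹ * x⁻¹ * (x⁻¹ + x⁻¹))
      have : (1 - W.a₄ * (x : F)⁻¹ * x⁻¹) = (x ^ 2 - W.a₄) * (x⁻¹ * x⁻¹) := by field_simp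
      simp only [Point.invX]
      rw [this, hx']
      have h1 : ((x ^ 2 - W.a₄) * (x⁻¹ * x⁻¹)) ^ 2 * (((x ^ 2 - W.a₄) / (2 * y)) ^ 2)⁻¹ =
        4 * y ^ 2 * (x⁻¹) ^ 4 := by field_simp; ring
      rw [h1, hE]
      field_simp
      ring

/-- Replacing Q by -Q exchanges P + Q and P - Q, so the sum and the product of their `x`-coordinates
depend only on those of P and Q. In terms of 1/x both symmetric functions are small, hence so are
the two values. This law replaces the formal group. -/
lemma Point.InKernel.parallelogram (hp : p ≠ 2) (ha : W.a₂ ∈ padicIntegers f)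
    (hb : W.a₄ ∈ padicIntegers f) {P Q : W.Point} (hP : P.InKernel f) (hQ : Q.InKernel f) :
    (P + Q).InKernel f ∧ (P - Q).InKernel f ∧
    (1 - W.a₄ * P.invX * Q.invX) ^ 2 * ((P + Q).invX + (P - Q).invX) =
      2 * (P.invX + Q.invX + 2 * W.a₂ * P.invX * Q.invX +
        W.a₄ * P.invX * Q.invX * (P.invX + Q.invX)) := by
  have hz : (0 : W.Point).invX = 0 := rfl
  have hk : (0 : W.Point).InKernel f := trivial
  by_cases hPQ : P = Q
  · subst hPQ
    obtain ⟨h1, h2⟩ := hP.double hp ha hb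
    refine ⟨h1, by rwa [sub_self], by rw [sub_self, hz, _root_.add_zero, h2]⟩
  by_cases hPQ' : P = -Q
  · subst hPQ'
    obtain ⟨h1, h2⟩ := hP.double hp ha hb
    refine ⟨by rwa [neg_add_cancel], by rwa [sub_eq_add_neg], ?_⟩
    rw [neg_add_cancel, hz, _root_.zero_add, sub_eq_add_neg (-Q) Q]
    simpa only [invX_neg] using h2
  cases P with
  | zero =>
    rw [← zero_def, _root_.zero_add, _root_.zero_sub, hz, invX_neg]
    exact ⟨hQ, hQ.neg, by ring⟩
  | some x₁ y₁ h₁ =>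
  cases Q with
  | zero =>
    rw [← zero_def, _root_.add_zero, _root_.sub_zero, hz]
    exact ⟨hP, hP, by ring⟩
  | some x₂ y₂ h₂ =>
  have hx : x₁ ≠ x₂ := by
    rintro rfl
    rcases X_eq_iff_of_isTwoTorsionNF h₁ h₂ with rfl | rfl
    · exact hPQ rfl
    · obtain ⟨h', e⟩ := neg_some_of_isTwoTorsionNF h₂
      exact hPQ' e.symm
  have hx₁ : 1 < ‖f x₁‖ := hP
  have hx₂ : 1 < ‖f x₂‖ := hQ
  have h10 : x₁ ≠ 0 := fun h ↦ by rw [h] at hx₁; simp at hx₁; linarith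
  have h20 : x₂ ≠ 0 := fun h ↦ by rw [h] at hx₂; simp at hx₂; linarith
  have E₁ := equation_iff_of_isTwoTorsionNF.mp h₁.1
  have E₂ := equation_iff_of_isTwoTorsionNF.mp h₂.1
  obtain ⟨x₃, y₃, h₃, e₃, hx₃⟩ := exists_add_of_X_ne h₁ h₂ hx
  obtain ⟨x₄, y₄, h₄, e₄, hx₄⟩ := exists_sub_of_X_ne h₁ h₂ hx
  rw [e₃, e₄]
  have hd : x₁ - x₂ ≠ 0 := sub_ne_zero.mpr hx
  have hsum : (x₁ - x₂) ^ 2 * (x₃ + x₄) =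
      2 * (x₁ * x₂ * (x₁ + x₂) + 2 * W.a₂ * x₁ * x₂ + W.a₄ * (x₁ + x₂)) := by
    have e₁ := div_mul_cancel₀ (y₁ - y₂) hd
    have e₂ := div_mul_cancel₀ (y₁ + y₂) hd
    rw [hx₃, hx₄]
    linear_combination (((y₁ - y₂) / (x₁ - x₂)) * (x₁ - x₂) + (y₁ - y₂)) * e₁ +
      (((y₁ + y₂) / (x₁ - x₂)) * (x₁ - x₂) + (y₁ + y₂)) * e₂ + 2 * E₁ + 2 * E₂
  have hprod : (x₁ - x₂) ^ 2 * (x₃ * x₄) = (x₁ * x₂ - W.a₄) ^ 2 := by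
    have e₁ := div_mul_cancel₀ (y₁ - y₂) hd
    have e₂ := div_mul_cancel₀ (y₁ + y₂) hd
    rw [hx₃, hx₄]
    refine mul_left_cancel₀ (pow_ne_zero 2 hd) ?_
    set ℓ := (y₁ - y₂) / (x₁ - x₂)
    set k := (y₁ + y₂) / (x₁ - x₂)
    have A : (x₁ - x₂) ^ 2 * ℓ ^ 2 = y₁ ^ 2 + y₂ ^ 2 - 2 * y₁ * y₂ := by
      linear_combination (ℓ * (x₁ - x₂) + (y₁ - y₂)) * e₁
    have B : (x₁ - x₂) ^ 2 * k ^ 2 = y₁ ^ 2 + y₂ ^ 2 + 2 * y₁ * y₂ := by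
      linear_combination (k * (x₁ - x₂) + (y₁ + y₂)) * e₂
    have C : (x₁ - x₂) ^ 2 * ((x₁ - x₂) ^ 2 * ((ℓ ^ 2 - W.a₂ - x₁ - x₂) *
        (k ^ 2 - W.a₂ - x₁ - x₂))) = ((x₁ - x₂) ^ 2 * ℓ ^ 2 - (W.a₂ + x₁ + x₂) * (x₁ - x₂) ^ 2) *
        ((x₁ - x₂) ^ 2 * k ^ 2 - (W.a₂ + x₁ + x₂) * (x₁ - x₂) ^ 2) := by ring
    rw [C, A, B]
    have D : (y₁ ^ 2 + y₂ ^ 2 - 2 * y₁ * y₂ - (W.a₂ + x₁ + x₂) * (x₁ - x₂) ^ 2) *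
        (y₁ ^ 2 + y₂ ^ 2 + 2 * y₁ * y₂ - (W.a₂ + x₁ + x₂) * (x₁ - x₂) ^ 2) =
        (y₁ ^ 2 + y₂ ^ 2 - (W.a₂ + x₁ + x₂) * (x₁ - x₂) ^ 2) ^ 2 - 4 * (y₁ ^ 2) * y₂ ^ 2 := by
      ring
    rw [D, E₁, E₂]
    ring
  -- sum and product of the inverses are small
  set s := x₁⁻¹ with hs
  set t := x₂⁻¹ with ht
  have hs1 : ‖f s‖ < 1 := hP.norm_invX_lt
  have ht1 : ‖f t‖ < 1 := hQ.norm_invX_lt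
  have hs0 : s * x₁ = 1 := inv_mul_cancel₀ h10
  have ht0 : t * x₂ = 1 := inv_mul_cancel₀ h20
  have hu : ‖f (1 - W.a₄ * s * t)‖ = 1 := by
    apply norm_map_one_sub
    rw [show W.a₄ * s * t = s * (t * W.a₄) by ring]
    exact mul_self_norm_lt_of_mem f hs1 (mul_mem ht1.le hb)
  have hu0 : 1 - W.a₄ * s * t ≠ 0 := fun h ↦ by rw [h] at hu; simp at hu
  have hprod' : (t - s) ^ 2 * (x₃ * x₄) = (1 - W.a₄ * s * t) ^ 2 := by
    have a1 : t - s = s * t * (x₁ - x₂) := by linear_combination (-t) * hs0 + s * ht0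
    have a2 : 1 - W.a₄ * s * t = s * t * (x₁ * x₂ - W.a₄) := by
      linear_combination (-1) * hs0 - s * x₁ * ht0
    rw [a1, a2]; linear_combination (s * t) ^ 2 * hprod
  have hx34 : x₃ * x₄ ≠ 0 := fun h ↦ by
    rw [h, mul_zero] at hprod'; exact hu0 (pow_eq_zero_iff (two_ne_zero) |>.mp hprod'.symm)
  have hx₃0 := left_ne_zero_of_mul hx34
  have hx₄0 := right_ne_zero_of_mul hx34
  have hsum' : (1 - W.a₄ * s * t) ^ 2 * (x₃⁻¹ + x₄⁻¹) =
      2 * (s + t + 2 * W.a₂ * s * t + W.a₄ * s * t * (s + t)) := by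
    have a1 : x₃⁻¹ + x₄⁻¹ = (x₃ + x₄) / (x₃ * x₄) := by field_simp; ring
    have a2 : t - s = s * t * (x₁ - x₂) := by linear_combination (-t) * hs0 + s * ht0
    rw [a1, ← hprod', a2]
    have a3 : (s * t * (x₁ - x₂)) ^ 2 * (x₃ * x₄) * ((x₃ + x₄) / (x₃ * x₄)) =
      (s * t) ^ 2 * ((x₁ - x₂) ^ 2 * (x₃ + x₄)) := by field_simp
    rw [a3, hsum, hs, ht]
    field_simp
    ring
  -- The denominator of the law is a unit congruent to 1, so dividing by it preserves integrality.
  obtain ⟨u, hinv, hu1⟩ : ∃ u ∈ padicIntegers f, u * (1 - W.a₄ * s * t) = 1 :=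
    ⟨(1 - W.a₄ * s * t)⁻¹, by rw [mem_padicIntegers, map_inv₀, norm_inv, hu, inv_one],
      inv_mul_cancel₀ hu0⟩
  have hS : ‖f (x₃⁻¹ + x₄⁻¹)‖ < 1 := by
    have : x₃⁻¹ + x₄⁻¹ = s * (2 * (1 + 2 * W.a₂ * t + W.a₄ * t * (s + t)) *
        u ^ 2) + t * (2 * u ^ 2) := by
      linear_combination u ^ 2 * hsum' -
        (x₃⁻¹ + x₄⁻¹) * (1 + u * (1 - W.a₄ * s * t)) * hu1
    rw [this, map_add]
    have h2 : (2 : F) ∈ padicIntegers f := natCast_mem _ 2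
    refine lt_of_le_of_lt (Padic.nonarchimedean _ _) (max_lt ?_ ?_)
    · refine mul_self_norm_lt_of_mem f hs1 (mul_mem (mul_mem h2 (add_mem (add_mem (one_mem _) ?_) ?_))
        (pow_mem hinv 2))
      · exact mul_mem (mul_mem h2 ha) ht1.le
      · exact mul_mem (mul_mem hb ht1.le) (add_mem hs1.le ht1.le)
    · exact mul_self_norm_lt_of_mem f ht1 (mul_mem h2 (pow_mem hinv 2))
  have hQ : ‖f (x₃⁻¹ * x₄⁻¹)‖ < 1 := by
    have : x₃⁻¹ * x₄⁻¹ = (t - s) * ((t - s) * u ^ 2) := by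
      rw [← mul_inv]
      refine inv_eq_of_mul_eq_one_right ?_
      linear_combination u ^ 2 * hprod' + (1 + u * (1 - W.a₄ * s * t)) * hu1
    rw [this]
    have hts : ‖f (t - s)‖ < 1 := by
      rw [sub_eq_add_neg, map_add]
      exact lt_of_le_of_lt (Padic.nonarchimedean _ _) (max_lt ht1 (by simpa using hs1))
    exact mul_self_norm_lt_of_mem f hts (mul_mem hts.le (pow_mem hinv 2))
  refine ⟨?_, ?_, hsum'⟩
  · have := norm_map_lt_of_root f (z := x₃⁻¹) (by ring) hS hQ
    rw [map_inv₀, norm_inv] at this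
    exact (inv_lt_one₀ (norm_pos_iff.mpr (by simpa using hx₃0))).mp this
  · have := norm_map_lt_of_root f (z := x₄⁻¹) (by ring) hS hQ
    rw [map_inv₀, norm_inv] at this
    exact (inv_lt_one₀ (norm_pos_iff.mpr (by simpa using hx₄0))).mp this

lemma Point.InKernel.nsmul (hp : p ≠ 2) (ha : W.a₂ ∈ padicIntegers f)
    (hb : W.a₄ ∈ padicIntegers f) {P : W.Point} (hP : P.InKernel f) (n : ℕ) :
    (n • P).InKernel f := by
  induction n with
  | zero => rw [zero_smul]; trivial
  | succ n ih => rw [succ_nsmul]; exact (ih.parallelogram hp ha hb hP).1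

end Kernel

end WeierstrassCurve.Affine

/-! ### Torsion injects into the points modulo an odd prime of good reduction. -/

namespace WeierstrassCurve.Affine

open IsTwoTorsionNF

section Reduction

variable {F : Type*} [Field F] {p : ℕ} [Fact p.Prime] {f : F →+* ℚ_[p]} {W : Affine F}

variable (f) in
open Classical in
/-- Reduction of points modulo `p`; points that are not integral are sent to `none`. -/
noncomputable def Point.reduction : W.Point → Option (ZMod p × ZMod p)
  | .zero => none
  | .some x y _ =>
    if h : x ∈ padicIntegers f ∧ y ∈ padicIntegers f then
      Option.some (padicResidue f ⟨x, h.1⟩, padicResidue f ⟨y, h.2⟩) else none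

variable [hW : IsTwoTorsionNF W]

lemma mem_padicIntegers_of_equation {x y : F} (ha : W.a₂ ∈ padicIntegers f)
    (hb : W.a₄ ∈ padicIntegers f) (h : W.Equation x y) (hx : x ∈ padicIntegers f) :
    y ∈ padicIntegers f := by
  have h1 : y ^ 2 ∈ padicIntegers f := by
    rw [equation_iff_of_isTwoTorsionNF.mp h]
    exact add_mem (add_mem (pow_mem hx 3) (mul_mem ha (pow_mem hx 2))) (mul_mem hb hx)
  rw [mem_padicIntegers, map_pow, norm_pow] at h1
  rw [mem_padicIntegers]
  exact (sq_le_one_iff₀ (norm_nonneg _)).mp h1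

lemma residue_equation {x y : F} (ha : W.a₂ ∈ padicIntegers f)
    (hb : W.a₄ ∈ padicIntegers f) (h : W.Equation x y) (hx : x ∈ padicIntegers f)
    (hy : y ∈ padicIntegers f) :
    padicResidue f ⟨y, hy⟩ ^ 2 = padicResidue f ⟨x, hx⟩ ^ 3 +
      padicResidue f ⟨_, ha⟩ * padicResidue f ⟨x, hx⟩ ^ 2 +
      padicResidue f ⟨_, hb⟩ * padicResidue f ⟨x, hx⟩ := by
  simp only [← map_pow, ← map_mul, ← map_add]
  congr 1
  exact Subtype.ext (equation_iff_of_isTwoTorsionNF.mp h)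

variable [DecidableEq F]

/-- Approximation of the inverse of the `x`-coordinate of `n • P` on the kernel of reduction. -/
lemma Point.InKernel.invX_nsmul (hp : p ≠ 2) (ha : W.a₂ ∈ padicIntegers f)
    (hb : W.a₄ ∈ padicIntegers f) {P : W.Point} (hP : P.InKernel f) (n : ℕ) :
    ∃ c : ℤ, 3 * c = n ^ 2 * (n ^ 2 - 1) ∧ ∃ r ∈ padicIntegers f,
      (n • P).invX = n ^ 2 * P.invX + W.a₂ * c * P.invX ^ 2 + P.invX ^ 3 * r := by
  induction n using Nat.twoStepInduction with
  | zero => exact ⟨0, by simp, 0, zero_mem _, by rw [zero_smul]; change (0 : F) = _; simp⟩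
  | one => exact ⟨0, by simp, 0, zero_mem _, by rw [one_smul]; simp⟩
  | more n ih₀ ih₁ =>
    obtain ⟨c₀, hc₀, r₀, hr₀, e₀⟩ := ih₀
    obtain ⟨c, hc, r, hr, e⟩ := ih₁
    have hk := (hP.nsmul hp ha hb (n + 1))
    -- The law for (n + 1)P and P is a second-order recursion for 1/x(nP).
    obtain ⟨-, -, key⟩ := hk.parallelogram hp ha hb hP
    have h1 : (n + 1) • P + P = (n + 2) • P := by rw [← succ_nsmul]
    have h2 : (n + 1) • P - P = n • P := by rw [succ_nsmul, add_sub_cancel_right]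
    rw [h1, h2] at key
    have hs1 := hP.norm_invX_lt
    set s := P.invX
    have hs : s ∈ padicIntegers f := hs1.le
    set a := W.a₂
    set b := W.a₄
    push_cast at hc e hc₀
    set m : F := (n : F) + 1
    set g : F := m ^ 2 + a * c * s + s ^ 2 * r with hg
    have hm : m ∈ padicIntegers f := add_mem (natCast_mem _ n) (one_mem _)
    have hcm : (c : F) ∈ padicIntegers f := intCast_mem _ c
    have hgm : g ∈ padicIntegers f := by
      exact add_mem (add_mem (pow_mem hm 2) (mul_mem (mul_mem ha hcm) hs))
        (mul_mem (pow_mem hs 2) hr)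
    have eg : ((n + 1) • P).invX = s * g := by rw [e, hg]; ring
    have hu : ‖f (1 - b * (s * g) * s)‖ = 1 := by
      apply norm_map_one_sub
      rw [show b * (s * g) * s = s * (s * (g * b)) by ring]
      exact mul_self_norm_lt_of_mem f hs1 (mul_mem hs (mul_mem hgm hb))
    have hu0 : 1 - b * (s * g) * s ≠ 0 := fun h ↦ by rw [h] at hu; simp at hu
    obtain ⟨u, hum, hu1⟩ : ∃ u ∈ padicIntegers f, u * (1 - b * (s * g) * s) = 1 :=
      ⟨(1 - b * (s * g) * s)⁻¹, by rw [mem_padicIntegers, map_inv₀, norm_inv, hu, inv_one],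
        inv_mul_cancel₀ hu0⟩
    rw [eg, e₀] at key
    -- The integer is the recursion read off at order s². The denominator equals 1 up to order s²,
    -- and what it multiplies is divisible by s, so its effect goes into the integral coefficient of
    -- s³.
    refine ⟨2 * c + 4 * ((n : ℤ) + 1) ^ 2 - c₀, by push_cast; linear_combination 2 * hc - hc₀,
      -r₀ + 2 * r + 4 * a * (a * c + s * r) + 2 * b * g * (1 + g) +
        2 * (g + 1 + 2 * a * s * g + b * s ^ 2 * g * (g + 1)) * b * g * u * (1 + u), ?_, ?_⟩
    · have h2 : (2 : F) ∈ padicIntegers f := natCast_mem _ 2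
      have h4 : (4 : F) ∈ padicIntegers f := natCast_mem _ 4
      have h1 : (1 : F) ∈ padicIntegers f := one_mem _
      have hg1 := add_mem hgm h1
      refine add_mem (add_mem (add_mem (add_mem (neg_mem hr₀) (mul_mem h2 hr)) ?_) ?_) ?_
      · exact mul_mem (mul_mem h4 ha) (add_mem (mul_mem ha hcm) (mul_mem hs hr))
      · exact mul_mem (mul_mem (mul_mem h2 hb) hgm) (add_mem h1 hgm)
      · refine mul_mem (mul_mem (mul_mem (mul_mem (mul_mem h2 ?_) hb) hgm) hum) (add_mem h1 hum)
        exact add_mem (add_mem hg1 (mul_mem (mul_mem (mul_mem h2 ha) hs) hgm))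
          (mul_mem (mul_mem (mul_mem hb (pow_mem hs 2)) hgm) hg1)
    · push_cast
      have hu2 : u = 1 + b * s ^ 2 * g * u := by linear_combination hu1
      have hcF : 3 * (c : F) = m ^ 2 * (m ^ 2 - 1) := by
        have := congr_arg (Int.cast : ℤ → F) hc
        push_cast at this
        exact this
      have key2 : ((n + 2) • P).invX = u ^ 2 * (2 * (s * g + s + 2 * a * (s * g) * s +
          b * (s * g) * s * (s * g + s))) - (n ^ 2 * s + a * c₀ * s ^ 2 + s ^ 3 * r₀) := by
        linear_combination u ^ 2 * key - (((n + 2) • P).invX +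
          (n ^ 2 * s + a * c₀ * s ^ 2 + s ^ 3 * r₀)) * (1 + u * (1 - b * (s * g) * s)) * hu1
      have hu3 : u ^ 2 = 1 + b * s ^ 2 * g * u * (1 + u) := by
        linear_combination (1 + u) * hu2
      rw [key2, hu3]
      simp only [hg]
      ring

/-- If qP = 0, dividing the expansion of 1/x(qP) by s leaves q² = -s(a₂c + sr). For q ≠ p the left
side is a unit and the right side is not. For q = p the factor s has valuation at least 2 and the
other factor at least 1, against valuation 2 on the left. -/
lemma Point.InKernel.prime_nsmul_ne_zero (hp : p ≠ 2) (ha : W.a₂ ∈ padicIntegers f)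
    (hb : W.a₄ ∈ padicIntegers f) {P : W.Point} (hP : P.InKernel f) (h0 : P ≠ 0) {q : ℕ}
    (hq : q.Prime) : q • P ≠ 0 := by
  intro hqP
  obtain ⟨c, hc, r, hr, e⟩ := hP.invX_nsmul hp ha hb q
  have hs0 := hP.invX_ne_zero h0
  have hs1 := hP.norm_invX_lt
  have hpp : p.Prime := Fact.out
  have hp2 : (2 : ℝ) ≤ p := by exact_mod_cast hpp.two_le
  have hsp : ‖f P.invX‖ < (p : ℝ)⁻¹ := by
    cases P with
    | zero => exact absurd rfl h0
    | some x y h => exact norm_inv_lt_inv ha hb h.1 hP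
  rw [hqP] at e
  change (0 : F) = _ at e
  set s := P.invX
  have e2 : ((q : F)) ^ 2 = -(s * (W.a₂ * c + s * r)) := by
    apply mul_left_cancel₀ hs0
    linear_combination -e
  have hsO : s ∈ padicIntegers f := hs1.le
  have hcO : (c : F) ∈ padicIntegers f := intCast_mem _ c
  by_cases hqp : q = p
  · subst hqp
    have hcn : ‖f (c : F)‖ ≤ (q : ℝ)⁻¹ := by
      -- From 3c = q²(q² - 1) the divisibility is clear when q ≠ 3; for q = 3 the value is c = 24.
      have hqc : (q : ℤ) ∣ c := by
        by_cases h3 : q = 3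
        · subst h3; exact ⟨8, by push_cast at hc; omega⟩
        · have : (q : ℤ) ∣ 3 * c := by rw [hc]; exact Dvd.dvd.mul_right (dvd_pow_self _ two_ne_zero) _
          refine (IsCoprime.dvd_of_dvd_mul_left ?_ this)
          rw [Int.isCoprime_iff_gcd_eq_one]
          exact_mod_cast (Nat.coprime_primes hq Nat.prime_three).mpr h3
      obtain ⟨d, hd⟩ := hqc
      rw [hd, Int.cast_mul, map_mul, norm_mul, Int.cast_natCast, map_natCast, Padic.norm_p, map_intCast]
      exact mul_le_of_le_one_right (by positivity) (Padic.norm_int_le_one d)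
    have h1 := congr_arg (fun z ↦ ‖f z‖) e2
    simp only [map_pow, map_natCast, norm_pow, Padic.norm_p, map_neg, norm_neg, map_mul, norm_mul]
      at h1
    have h3 : ‖f (W.a₂ * c + s * r)‖ ≤ (q : ℝ)⁻¹ := by
      rw [map_add]
      refine (Padic.nonarchimedean _ _).trans (max_le ?_ ?_)
      · rw [map_mul, norm_mul]
        exact (mul_le_of_le_one_left (norm_nonneg _) ha).trans hcn
      · rw [map_mul, norm_mul]
        exact (mul_le_of_le_one_right (norm_nonneg _) hr).trans hsp.le
    have h4 : (0 : ℝ) < (q : ℝ)⁻¹ := by positivity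
    nlinarith [norm_nonneg (f (W.a₂ * c + s * r)), norm_nonneg (f s)]
  · have h1 : ‖f ((q : F) ^ 2)‖ = 1 := by
      rw [map_pow, map_natCast, norm_pow, Padic.norm_natCast_eq_one_iff.mpr, one_pow]
      exact (Nat.coprime_primes hpp hq).mpr fun h ↦ hqp h.symm
    have h2 : ‖f (s * (W.a₂ * c + s * r))‖ < 1 :=
      mul_self_norm_lt_of_mem f hs1 (add_mem (mul_mem ha hcO) (mul_mem hsO hr))
    rw [e2, map_neg, norm_neg] at h1
    linarith

/-- The kernel of reduction modulo an odd prime is torsion-free. -/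
lemma Point.InKernel.eq_zero_of_isOfFinAddOrder (hp : p ≠ 2) (ha : W.a₂ ∈ padicIntegers f)
    (hb : W.a₄ ∈ padicIntegers f) {P : W.Point} (hP : P.InKernel f) (h : IsOfFinAddOrder P) :
    P = 0 := by
  obtain ⟨n, hn, hnP⟩ := isOfFinAddOrder_iff_nsmul_eq_zero.mp h
  clear h
  induction n using induction_on_primes generalizing P with
  | zero => exact absurd hn (lt_irrefl 0)
  | one => simpa using hnP
  | prime_mul q m hq ih =>
    by_contra h0
    have h1 := hP.prime_nsmul_ne_zero hp ha hb h0 hq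
    refine h1 (ih (hP.nsmul hp ha hb q) (Nat.pos_of_mul_pos_left hn) ?_)
    rwa [← mul_nsmul]

lemma Point.exists_reduction_eq_some (hp : p ≠ 2) (ha : W.a₂ ∈ padicIntegers f)
    (hb : W.a₄ ∈ padicIntegers f) {x y : F} {h : W.Nonsingular x y}
    (hP : IsOfFinAddOrder (some x y h)) : ∃ (hx : x ∈ padicIntegers f) (hy : y ∈ padicIntegers f),
    (some x y h).reduction f = .some (padicResidue f ⟨x, hx⟩, padicResidue f ⟨y, hy⟩) := by
  have hx : x ∈ padicIntegers f := by
    by_contra hx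
    rw [mem_padicIntegers, not_le] at hx
    exact some_ne_zero h (InKernel.eq_zero_of_isOfFinAddOrder (P := some x y h) hp ha hb hx hP)
  have hy := mem_padicIntegers_of_equation ha hb h.1 hx
  exact ⟨hx, hy, dif_pos ⟨hx, hy⟩⟩

/-- At a prime of good reduction, two integral points with the same reduction differ by an element
of the kernel of reduction. -/
lemma Point.sub_inKernel (hp : p ≠ 2) (ha : W.a₂ ∈ padicIntegers f)
    (hb : W.a₄ ∈ padicIntegers f) (hb0 : padicResidue f ⟨_, hb⟩ ≠ 0)
    (hd : padicResidue f ⟨_, ha⟩ ^ 2 - 4 * padicResidue f ⟨_, hb⟩ ≠ 0)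
    {x₁ y₁ x₂ y₂ : F} {h₁ : W.Nonsingular x₁ y₁} {h₂ : W.Nonsingular x₂ y₂}
    (hx₁ : x₁ ∈ padicIntegers f) (hx₂ : x₂ ∈ padicIntegers f)
    (hy₁ : y₁ ∈ padicIntegers f) (hy₂ : y₂ ∈ padicIntegers f)
    (hx : padicResidue f ⟨x₁, hx₁⟩ = padicResidue f ⟨x₂, hx₂⟩)
    (hy : padicResidue f ⟨y₁, hy₁⟩ = padicResidue f ⟨y₂, hy₂⟩) :
    (some x₁ y₁ h₁ - some x₂ y₂ h₂).InKernel f := by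
  have hpp : p.Prime := Fact.out
  have h20 : (2 : ZMod p) ≠ 0 := by
    have : ((2 : ℕ) : ZMod p) ≠ 0 := by
      rw [ne_eq, ZMod.natCast_eq_zero_iff]
      exact fun h ↦ hp ((Nat.prime_dvd_prime_iff_eq hpp Nat.prime_two).mp h)
    exact_mod_cast this
  have E₁ := equation_iff_of_isTwoTorsionNF.mp h₁.1
  have E₂ := equation_iff_of_isTwoTorsionNF.mp h₂.1
  have R₁ := residue_equation ha hb h₁.1 hx₁ hy₁
  by_cases hX : x₁ = x₂
  · subst hX
    rcases X_eq_iff_of_isTwoTorsionNF h₁ h₂ with rfl | hY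
    · rw [sub_self]; trivial
    · obtain ⟨h', e'⟩ := neg_some_of_isTwoTorsionNF h₂
      -- The points are opposite with equal reductions, so the difference is a double and y vanishes
      -- modulo p.
      have e : some x₁ y₁ h₁ - some x₁ y₂ h₂ = some x₁ y₁ h₁ + some x₁ y₁ h₁ := by
        rw [sub_eq_add_neg, e']
        congr 1
        simp only [some.injEq, true_and]
        exact hY.symm
      rw [e]
      have hres : padicResidue f ⟨y₁, hy₁⟩ = 0 := by
        have h1 : padicResidue f ⟨y₁, hy₁⟩ = -padicResidue f ⟨y₂, hy₂⟩ := by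
          rw [← map_neg]; congr 1; exact Subtype.ext hY
        have : 2 * padicResidue f ⟨y₁, hy₁⟩ = 0 := by
          linear_combination h1 + hy
        exact (mul_eq_zero.mp this).resolve_left h20
      by_cases hY0 : 2 * y₁ = 0
      · rw [add_self_eq_zero h₁ hY0]; trivial
      obtain ⟨x', y', h'', e'', hx'⟩ := exists_add_self h₁ hY0
      rw [e'']
      change 1 < ‖f x'‖
      have hyn := (padicResidue_eq_zero_iff f).mp hres
      have hm : x₁ ^ 2 - W.a₄ ∈ padicIntegers f := sub_mem (pow_mem hx₁ 2) hb
      -- Otherwise the residue of x₁ would be a multiple root of the reduced cubic, against good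
      -- reduction.
      have hxn : ‖f (x₁ ^ 2 - W.a₄)‖ = 1 := by
        refine (padicResidue_ne_zero_iff f (z := ⟨_, hm⟩)).mp fun h0 ↦ ?_
        have h0' : padicResidue f ⟨x₁, hx₁⟩ ^ 2 - padicResidue f ⟨_, hb⟩ = 0 := by
          rw [← map_pow, ← map_sub]; exact h0
        rw [hres] at R₁
        set X := padicResidue f ⟨x₁, hx₁⟩
        set A := padicResidue f ⟨_, ha⟩
        set B := padicResidue f ⟨_, hb⟩
        have hX0 : X ≠ 0 := fun h ↦ hb0 (by rw [h] at h0'; linear_combination -h0')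
        have h1 : 2 * X + A = 0 := by
          refine (mul_eq_zero.mp (?_ : X ^ 2 * (2 * X + A) = 0)).resolve_left (pow_ne_zero 2 hX0)
          linear_combination X * h0' - R₁
        exact hd (by linear_combination (A - 2 * X) * h1 + 4 * h0')
      have h2y : ‖f (2 * y₁)‖ < 1 := by
        rw [mul_comm]
        exact mul_self_norm_lt_of_mem f hyn (natCast_mem _ 2)
      have h2y0 : 0 < ‖f (2 * y₁)‖ := norm_pos_iff.mpr (by simpa using hY0)
      rw [hx', map_pow, map_div₀, norm_pow, norm_div, hxn]
      exact one_lt_pow₀ ((one_lt_div h2y0).mpr h2y) two_ne_zero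
  · obtain ⟨x, y, h, e, hx'⟩ := exists_sub_of_X_ne h₁ h₂ hX
    rw [e]
    change 1 < ‖f x‖
    have hd0 : x₁ - x₂ ≠ 0 := sub_ne_zero.mpr hX
    have hdn : ‖f (x₁ - x₂)‖ < 1 :=
      (padicResidue_eq_zero_iff f (z := ⟨_, sub_mem hx₁ hx₂⟩)).mp (by
        have : (⟨x₁ - x₂, sub_mem hx₁ hx₂⟩ : padicIntegers f) = ⟨x₁, hx₁⟩ - ⟨x₂, hx₂⟩ := rfl
        rw [this, map_sub, hx, sub_self])
    have hdp : 0 < ‖f (x₁ - x₂)‖ := norm_pos_iff.mpr ((map_ne_zero f).mpr hd0)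
    -- If y₁ is a unit, so is y₁ + y₂. If not, factoring the difference of the two equations gives
    -- slope (y₁ + y₂)/(x₁ - x₂) = G/(y₁ - y₂), where G reduces to the derivative of the cubic at a
    -- simple root.
    have hℓ : 1 < ‖f ((y₁ + y₂) / (x₁ - x₂))‖ := by
      by_cases hY0 : padicResidue f ⟨y₁, hy₁⟩ = 0
      · have hG : x₁ ^ 2 + x₁ * x₂ + x₂ ^ 2 + W.a₂ * (x₁ + x₂) + W.a₄ ∈ padicIntegers f :=
          add_mem (add_mem (add_mem (add_mem (pow_mem hx₁ 2) (mul_mem hx₁ hx₂)) (pow_mem hx₂ 2))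
            (mul_mem ha (add_mem hx₁ hx₂))) hb
        have hGn : ‖f (x₁ ^ 2 + x₁ * x₂ + x₂ ^ 2 + W.a₂ * (x₁ + x₂) + W.a₄)‖ = 1 := by
          refine (padicResidue_ne_zero_iff f (z := ⟨_, hG⟩)).mp fun h0 ↦ ?_
          have h0' : padicResidue f ⟨x₁, hx₁⟩ ^ 2 + padicResidue f ⟨x₁, hx₁⟩ *
              padicResidue f ⟨x₂, hx₂⟩ + padicResidue f ⟨x₂, hx₂⟩ ^ 2 + padicResidue f ⟨_, ha⟩ *
              (padicResidue f ⟨x₁, hx₁⟩ + padicResidue f ⟨x₂, hx₂⟩) +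
              padicResidue f ⟨_, hb⟩ = 0 := by
            simp only [← map_pow, ← map_mul, ← map_add]; exact h0
          rw [← hx] at h0'
          rw [hY0] at R₁
          set X := padicResidue f ⟨x₁, hx₁⟩
          set A := padicResidue f ⟨_, ha⟩
          set B := padicResidue f ⟨_, hb⟩
          by_cases hX0 : X = 0
          · rw [hX0] at h0'; exact hb0 (by linear_combination h0')
          · have h1 : X ^ 2 + A * X + B = 0 := by
              refine (mul_eq_zero.mp (?_ : X * (X ^ 2 + A * X + B) = 0)).resolve_left hX0
              linear_combination -R₁
            have h2 : X * (2 * X + A) = 0 := by linear_combination h0' - h1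
            have h3 := (mul_eq_zero.mp h2).resolve_left hX0
            exact hd (by linear_combination (A + 2 * X) * h3 - 4 * h1)
        have hfac : (y₁ - y₂) * (y₁ + y₂) =
            (x₁ - x₂) * (x₁ ^ 2 + x₁ * x₂ + x₂ ^ 2 + W.a₂ * (x₁ + x₂) + W.a₄) := by
          linear_combination E₁ - E₂
        have hyd : ‖f (y₁ - y₂)‖ < 1 :=
          (padicResidue_eq_zero_iff f (z := ⟨_, sub_mem hy₁ hy₂⟩)).mp (by
            have : (⟨y₁ - y₂, sub_mem hy₁ hy₂⟩ : padicIntegers f) = ⟨y₁, hy₁⟩ - ⟨y₂, hy₂⟩ := rfl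
            rw [this, map_sub, hy, sub_self])
        have hn := congr_arg (fun z ↦ ‖f z‖) hfac
        simp only [map_mul, norm_mul, hGn, mul_one] at hn
        rw [map_div₀, norm_div, one_lt_div hdp, ← hn]
        have hpos : 0 < ‖f (y₁ + y₂)‖ := by
          rcases (norm_nonneg (f (y₁ + y₂))).lt_or_eq with h | h
          · exact h
          · rw [← h, mul_zero] at hn; linarith
        nlinarith
      · have hm : y₁ + y₂ ∈ padicIntegers f := add_mem hy₁ hy₂
        have hyn : ‖f (y₁ + y₂)‖ = 1 := by
          refine (padicResidue_ne_zero_iff f (z := ⟨_, hm⟩)).mp fun h0 ↦ ?_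
          have : padicResidue f ⟨y₁, hy₁⟩ + padicResidue f ⟨y₂, hy₂⟩ = 0 := by
            rw [← map_add]; exact h0
          rw [← hy, ← two_mul] at this
          exact (mul_ne_zero h20 hY0) this
        rw [map_div₀, norm_div, hyn]
        exact (one_lt_div hdp).mpr hdn
    have hsm : ‖f (-(W.a₂ + x₁ + x₂))‖ ≤ 1 := neg_mem (add_mem (add_mem ha hx₁) hx₂)
    have hℓ2 : 1 < ‖f (((y₁ + y₂) / (x₁ - x₂)) ^ 2)‖ := by
      rw [map_pow, norm_pow]; exact one_lt_pow₀ hℓ two_ne_zero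
    rw [show x = ((y₁ + y₂) / (x₁ - x₂)) ^ 2 + -(W.a₂ + x₁ + x₂) by rw [hx']; ring, map_add,
      Padic.add_eq_max_of_ne (hsm.trans_lt hℓ2).ne']
    exact lt_max_of_lt_left hℓ2

lemma Point.injOn_reduction (hp : p ≠ 2) (ha : W.a₂ ∈ padicIntegers f)
    (hb : W.a₄ ∈ padicIntegers f) (hb0 : padicResidue f ⟨_, hb⟩ ≠ 0)
    (hd : padicResidue f ⟨_, ha⟩ ^ 2 - 4 * padicResidue f ⟨_, hb⟩ ≠ 0) :
    Set.InjOn (reduction f) {P : W.Point | IsOfFinAddOrder P} := by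
  intro P hP Q hQ hPQ
  cases P with
  | zero =>
    cases Q with
    | zero => rfl
    | some x y h =>
      obtain ⟨hx, hy, e⟩ := exists_reduction_eq_some hp ha hb hQ
      rw [e] at hPQ; exact absurd hPQ (by simp [reduction])
  | some x₁ y₁ h₁ =>
    obtain ⟨hx₁, hy₁, e₁⟩ := exists_reduction_eq_some hp ha hb hP
    cases Q with
    | zero => rw [e₁] at hPQ; exact absurd hPQ (by simp [reduction])
    | some x₂ y₂ h₂ =>
      obtain ⟨hx₂, hy₂, e₂⟩ := exists_reduction_eq_some hp ha hb hQ
      rw [e₁, e₂, Option.some.injEq, Prod.mk.injEq] at hPQ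
      have hk := sub_inKernel (h₁ := h₁) (h₂ := h₂) hp ha hb hb0 hd hx₁ hx₂ hy₁ hy₂ hPQ.1 hPQ.2
      refine sub_eq_zero.mp (hk.eq_zero_of_isOfFinAddOrder hp ha hb ?_)
      exact (AddCommGroup.torsion W.Point).sub_mem hP hQ

/-- The torsion subgroup is no larger than the group of points modulo a prime of good reduction. -/
theorem card_torsion_le (hp : p ≠ 2) (ha : W.a₂ ∈ padicIntegers f)
    (hb : W.a₄ ∈ padicIntegers f) {A B : ZMod p} (hA : padicResidue f ⟨_, ha⟩ = A)
    (hB : padicResidue f ⟨_, hb⟩ = B) (hb0 : B ≠ 0) (hd : A ^ 2 - 4 * B ≠ 0) :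
    Finite (AddCommGroup.torsion W.Point) ∧ Nat.card (AddCommGroup.torsion W.Point) ≤
      -- The filter counts affine points; the added 1 is the point at infinity, the value `none` of
      -- the reduction.
      (Finset.univ.filter fun z : ZMod p × ZMod p ↦
        z.2 ^ 2 = z.1 ^ 3 + A * z.1 ^ 2 + B * z.1).card + 1 := by
  subst hA hB
  set S := Finset.univ.filter fun z : ZMod p × ZMod p ↦
        z.2 ^ 2 = z.1 ^ 3 + padicResidue f ⟨_, ha⟩ * z.1 ^ 2 + padicResidue f ⟨_, hb⟩ * z.1
  have hinj := Point.injOn_reduction hp ha hb hb0 hd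
  have hmem (P : W.Point) (hP : IsOfFinAddOrder P) :
      P.reduction f ∈ Finset.insertNone S := by
    cases P with
    | zero => exact Finset.none_mem_insertNone
    | some x y h =>
      obtain ⟨hx, hy, e⟩ := Point.exists_reduction_eq_some hp ha hb hP
      rw [e, Finset.some_mem_insertNone, Finset.mem_filter]
      exact ⟨Finset.mem_univ _, residue_equation ha hb h.1 hx hy⟩
  let φ : AddCommGroup.torsion W.Point → Finset.insertNone S :=
    fun P ↦ ⟨P.1.reduction f, hmem P.1 P.2⟩
  have hφ : Function.Injective φ := fun P Q h ↦
    Subtype.ext (hinj P.2 Q.2 (Subtype.ext_iff.mp h))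
  refine ⟨Finite.of_injective φ hφ, ?_⟩
  have := Nat.card_le_card_of_injective φ hφ
  rwa [Nat.card_eq_fintype_card (α := Finset.insertNone S), Fintype.card_coe,
    Finset.card_insertNone] at this

end Reduction

end WeierstrassCurve.Affine

/-! ### Square classes of `x`-coordinates: quartic coverings and local obstructions. -/

section SquareClasses

lemma Squarefree.eq_one_or_eq_of_forall_prime {n q : ℕ} (hn : Squarefree n)
    (h : ∀ p : ℕ, p.Prime → p ∣ n → p = q) : n = 1 ∨ n = q := by
  rw [← Nat.prod_primeFactors_of_squarefree hn]
  have hsub : n.primeFactors ⊆ {q} := fun p hp ↦ by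
    rw [Finset.mem_singleton]
    exact h p (Nat.prime_of_mem_primeFactors hp) (Nat.dvd_of_mem_primeFactors hp)
  rcases Finset.subset_singleton_iff.mp hsub with h | h <;> rw [h] <;> simp

lemma Rat.exists_eq_squarefree_mul_sq (x : ℚ) (hx : x ≠ 0) :
    ∃ (d m e : ℤ), Squarefree d ∧ IsCoprime m e ∧ m ≠ 0 ∧ e ≠ 0 ∧ x = d * (m / e) ^ 2 := by
  obtain ⟨c, b', hc, hsq⟩ := Nat.sq_mul_squarefree (x.num.natAbs * x.den)
  have hnum : x.num ≠ 0 := Rat.num_ne_zero.mpr hx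
  have hden : (x.den : ℚ) ≠ 0 := by exact_mod_cast x.den_ne_zero
  have hb0 : b' ≠ 0 := by
    rintro rfl
    have : x.num.natAbs * x.den ≠ 0 := mul_ne_zero (Int.natAbs_ne_zero.mpr hnum) x.den_ne_zero
    exact this (by rw [← hc]; simp)
  set r : ℚ := (b' : ℚ) / x.den with hr
  have hr0 : r ≠ 0 := div_ne_zero (by exact_mod_cast hb0) hden
  refine ⟨x.num.sign * c, r.num, r.den, ?_, ?_, Rat.num_ne_zero.mpr hr0,
    by exact_mod_cast r.den_ne_zero, ?_⟩
  · rw [← Int.squarefree_natAbs, Int.natAbs_mul, Int.natAbs_sign_of_ne_zero hnum, one_mul]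
    simpa using hsq
  · rw [Int.isCoprime_iff_gcd_eq_one]; exact r.reduced
  · have h1 : (r.num : ℚ) / ((r.den : ℤ) : ℚ) = r := by
      rw [Int.cast_natCast]; exact Rat.num_div_den r
    rw [h1, hr]
    have h2 : (x.num : ℚ) * x.den = x.num.sign * (b' ^ 2 * c) := by
      have h3 : x.num * x.den = x.num.sign * (b' ^ 2 * c : ℕ) := by
        rw [hc, Nat.cast_mul, ← mul_assoc, Int.sign_mul_natAbs]
      exact_mod_cast h3
    have h4 : x * x.den = x.num := Rat.mul_den_eq_num x
    push_cast
    field_simp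
    rw [mul_assoc, mul_comm (c : ℚ), ← h2, ← h4]
    ring

/-- A rational point on `y² = x³ + a x² + b x` yields an integral point on a quartic covering. -/
lemma exists_quartic_of_rational_point {a b : ℤ} {x y : ℚ} (hx : x ≠ 0)
    (h : y ^ 2 = x ^ 3 + a * x ^ 2 + b * x) :
    ∃ d m e N : ℤ, Squarefree d ∧ IsCoprime m e ∧ m ≠ 0 ∧ e ≠ 0 ∧ x = d * (m / e) ^ 2 ∧
      d * N ^ 2 = d ^ 2 * m ^ 4 + a * d * m ^ 2 * e ^ 2 + b * e ^ 4 ∧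
      ∀ p : ℕ, p.Prime → (p : ℤ) ∣ d → (p : ℤ) ∣ b := by
  obtain ⟨d, m, e, hd, hme, hm, he, hx'⟩ := x.exists_eq_squarefree_mul_sq hx
  have hmQ : (m : ℚ) ≠ 0 := by exact_mod_cast hm
  have heQ : (e : ℚ) ≠ 0 := by exact_mod_cast he
  have hd0 : d ≠ 0 := hd.ne_zero
  have hdQ : (d : ℚ) ≠ 0 := by exact_mod_cast hd0
  -- Clearing denominators makes t² an integer divisible by d. Hence t is an integer, and d divides
  -- t because d is squarefree.
  set t : ℚ := y * e ^ 3 / m with ht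
  have ht2 : t ^ 2 = ((d * (d ^ 2 * m ^ 4 + a * d * m ^ 2 * e ^ 2 + b * e ^ 4) : ℤ) : ℚ) := by
    rw [ht, div_pow, mul_pow, h, hx']
    push_cast
    field_simp
  have hden : t.den = 1 := by
    have h1 : (t ^ 2).den = 1 := by rw [ht2]; exact Rat.den_intCast _
    rw [Rat.den_pow] at h1
    exact (pow_eq_one_iff.mp h1).resolve_right two_ne_zero
  have htn : t = (t.num : ℚ) := by
    conv_lhs => rw [← Rat.num_div_den t, hden]
    simp
  have hT : t.num ^ 2 = d * (d ^ 2 * m ^ 4 + a * d * m ^ 2 * e ^ 2 + b * e ^ 4) := by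
    rw [htn] at ht2; exact_mod_cast ht2
  have hdT : d ∣ t.num := by
    refine (hd.dvd_pow_iff_dvd two_ne_zero).mp ?_
    rw [hT]; exact dvd_mul_right _ _
  obtain ⟨N, hN⟩ := hdT
  have hq : d * N ^ 2 = d ^ 2 * m ^ 4 + a * d * m ^ 2 * e ^ 2 + b * e ^ 4 := by
    apply mul_left_cancel₀ hd0
    rw [← hT, hN]; ring
  refine ⟨d, m, e, N, hd, hme, hm, he, hx', hq, fun p hp hpd ↦ ?_⟩
  -- If p divides d but not b, the quartic forces p to divide e, then N, then m, against
  -- coprimality.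
  by_contra hpb
  have hpZ : Prime (p : ℤ) := Nat.prime_iff_prime_int.mp hp
  obtain ⟨d', rfl⟩ := hpd
  have hpd' : ¬ (p : ℤ) ∣ d' := fun ⟨k, hk⟩ ↦ by
    refine hpZ.not_isUnit (hd p ⟨k, by rw [hk]; ring⟩)
  have hpe : (p : ℤ) ∣ e := by
    have : (p : ℤ) ∣ b * e ^ 4 :=
      ⟨d' * N ^ 2 - p * d' ^ 2 * m ^ 4 - a * d' * m ^ 2 * e ^ 2, by linear_combination -hq⟩
    exact hpZ.dvd_of_dvd_pow ((hpZ.dvd_or_dvd this).resolve_left hpb)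
  have hpm : ¬ (p : ℤ) ∣ m := fun h ↦ hpZ.not_isUnit (hme.isUnit_of_dvd' h hpe)
  obtain ⟨e', rfl⟩ := hpe
  have hpN : (p : ℤ) ∣ N := by
    have : (p : ℤ) ∣ d' * N ^ 2 :=
      ⟨d' ^ 2 * m ^ 4 + a * d' * m ^ 2 * p * e' ^ 2 + b * p ^ 2 * e' ^ 4,
        mul_left_cancel₀ hpZ.ne_zero (by linear_combination hq)⟩
    exact hpZ.dvd_of_dvd_pow ((hpZ.dvd_or_dvd this).resolve_left hpd')
  obtain ⟨N', rfl⟩ := hpN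
  have : (p : ℤ) ∣ d' ^ 2 * m ^ 4 :=
    ⟨d' * N' ^ 2 - a * d' * m ^ 2 * e' ^ 2 - b * p * e' ^ 4,
      mul_left_cancel₀ (pow_ne_zero 2 hpZ.ne_zero) (by linear_combination -hq)⟩
  rcases hpZ.dvd_or_dvd this with h | h
  · exact hpd' (hpZ.dvd_of_dvd_pow h)
  · exact hpm (hpZ.dvd_of_dvd_pow h)

/-- Removes the primes of the twisting parameter. If p divides both d and D, the quartic divided by
p² is a zero of u² + αuv + βv² modulo p at (dm²/p, De²/p); anisotropy then makes p divide m and e.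
-/
lemma not_dvd_of_anisotropic {α β D d m e N : ℤ} {p : ℕ} (hp : p.Prime) (hd : Squarefree d)
    (hme : IsCoprime m e) (hpD : (p : ℤ) ∣ D) (hpD2 : ¬ (p : ℤ) ^ 2 ∣ D)
    (han : ∀ u v : ZMod p, u ^ 2 + α * u * v + β * v ^ 2 = 0 → u = 0 ∧ v = 0)
    (h : d * N ^ 2 = d ^ 2 * m ^ 4 + α * D * d * m ^ 2 * e ^ 2 + β * D ^ 2 * e ^ 4) :
    ¬ (p : ℤ) ∣ d := by
  rintro ⟨d', rfl⟩
  obtain ⟨D', rfl⟩ := hpD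
  have hpZ : Prime (p : ℤ) := Nat.prime_iff_prime_int.mp hp
  have hpd' : ¬ (p : ℤ) ∣ d' := fun ⟨k, hk⟩ ↦ by
    refine hpZ.not_isUnit (hd p ⟨k, by rw [hk]; ring⟩)
  have hpD' : ¬ (p : ℤ) ∣ D' := fun ⟨k, hk⟩ ↦ hpD2 ⟨k, by rw [hk]; ring⟩
  have hpN : (p : ℤ) ∣ N := by
    have : (p : ℤ) ∣ d' * N ^ 2 :=
      ⟨d' ^ 2 * m ^ 4 + α * D' * d' * m ^ 2 * e ^ 2 + β * D' ^ 2 * e ^ 4,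
        mul_left_cancel₀ hpZ.ne_zero (by linear_combination h)⟩
    exact hpZ.dvd_of_dvd_pow ((hpZ.dvd_or_dvd this).resolve_left hpd')
  obtain ⟨N', rfl⟩ := hpN
  have hG : (d' * m ^ 2) ^ 2 + α * (d' * m ^ 2) * (D' * e ^ 2) + β * (D' * e ^ 2) ^ 2 =
      p * (d' * N' ^ 2) :=
    mul_left_cancel₀ (pow_ne_zero 2 hpZ.ne_zero) (by linear_combination -h)
  have hG' := congr_arg (Int.cast : ℤ → ZMod p) hG
  push_cast at hG'
  rw [ZMod.natCast_self, zero_mul] at hG'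
  obtain ⟨h1, h2⟩ := han _ _ hG'
  have h1' : (p : ℤ) ∣ d' * m ^ 2 := (ZMod.intCast_zmod_eq_zero_iff_dvd _ p).mp (by push_cast; exact h1)
  have h2' : (p : ℤ) ∣ D' * e ^ 2 := (ZMod.intCast_zmod_eq_zero_iff_dvd _ p).mp (by push_cast; exact h2)
  exact hpZ.not_isUnit (hme.isUnit_of_dvd'
    (hpZ.dvd_of_dvd_pow ((hpZ.dvd_or_dvd h1').resolve_left hpd'))
    (hpZ.dvd_of_dvd_pow ((hpZ.dvd_or_dvd h2').resolve_left hpD')))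

lemma IsCoprime.sq_cases {m e : ℤ} (h : IsCoprime m e) :
    (∃ i j, m ^ 2 = 8 * i + 1 ∧ e ^ 2 = 8 * j + 1) ∨ (∃ i j, m ^ 2 = 4 * i ∧ e ^ 2 = 8 * j + 1) ∨
      ∃ i j, m ^ 2 = 8 * i + 1 ∧ e ^ 2 = 4 * j := by
  have ho {z : ℤ} (hz : Odd z) : ∃ i, z ^ 2 = 8 * i + 1 := by
    obtain ⟨i, hi⟩ := Int.eight_dvd_sq_sub_one_of_odd hz
    exact ⟨i, by linarith⟩
  have he {z : ℤ} (hz : Even z) : ∃ i, z ^ 2 = 4 * i := by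
    obtain ⟨i, rfl⟩ := hz
    exact ⟨i ^ 2, by ring⟩
  rcases Int.even_or_odd m with hm | hm <;> rcases Int.even_or_odd e with hE | hE
  · exact absurd (h.isUnit_of_dvd' hm.two_dvd hE.two_dvd) (by decide)
  · obtain ⟨i, hi⟩ := he hm; obtain ⟨j, hj⟩ := ho hE; exact .inr (.inl ⟨i, j, hi, hj⟩)
  · obtain ⟨i, hi⟩ := ho hm; obtain ⟨j, hj⟩ := he hE; exact .inr (.inr ⟨i, j, hi, hj⟩)
  · obtain ⟨i, hi⟩ := ho hm; obtain ⟨j, hj⟩ := ho hE; exact .inl ⟨i, j, hi, hj⟩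

lemma Int.sq_ne_of_emod {N k r : ℤ} {n : ℕ} (h : ∀ z : ZMod n, z ^ 2 ≠ r) : N ^ 2 ≠ n * k + r := by
  intro hN
  refine h N ?_
  have := congr_arg (Int.cast : ℤ → ZMod n) hN
  push_cast at this
  rw [this, ZMod.natCast_self]; ring

/-- For m, e both odd the value is 12 modulo 16; if exactly one is even it is -1 modulo 8. Neither
is a square. -/
lemma quartic_ne_sq_of_emod_sixteen {α β γ m e N : ℤ} (h : IsCoprime m e) (hα : 8 ∣ α + 1)
    (hγ : 8 ∣ γ + 1) (hβ : 2 ∣ β) (hs : 16 ∣ α + β + γ - 12) :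
    N ^ 2 ≠ α * m ^ 4 + β * m ^ 2 * e ^ 2 + γ * e ^ 4 := by
  obtain ⟨α', hα⟩ := hα
  obtain ⟨β', rfl⟩ := hβ
  obtain ⟨γ', hγ⟩ := hγ
  obtain ⟨s, hs⟩ := hs
  obtain rfl : α = 8 * α' - 1 := by linarith
  obtain rfl : γ = 8 * γ' - 1 := by linarith
  rw [show m ^ 4 = (m ^ 2) ^ 2 by ring, show e ^ 4 = (e ^ 2) ^ 2 by ring]
  rcases h.sq_cases with ⟨i, j, hi, hj⟩ | ⟨i, j, hi, hj⟩ | ⟨i, j, hi, hj⟩ <;> rw [hi, hj]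
  · convert Int.sq_ne_of_emod (n := 16) (r := 12) (N := N) (by decide) using 1
    swap
    · exact s + (8 * α' - 1) * (4 * i ^ 2 + i) + (8 * γ' - 1) * (4 * j ^ 2 + j) +
        β' * (8 * i * j + i + j)
    · push_cast; linear_combination hs
  · convert Int.sq_ne_of_emod (n := 8) (r := -1) (N := N) (by decide) using 1
    swap
    · exact (8 * α' - 1) * (2 * i ^ 2) + β' * i * (8 * j + 1) + γ' +
        (8 * γ' - 1) * (8 * j ^ 2 + 2 * j)
    · push_cast; ring
  · convert Int.sq_ne_of_emod (n := 8) (r := -1) (N := N) (by decide) using 1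
    swap
    · exact (8 * γ' - 1) * (2 * j ^ 2) + β' * j * (8 * i + 1) + α' +
        (8 * α' - 1) * (8 * i ^ 2 + 2 * i)
    · push_cast; ring

/-- Here the coefficients sum to -16, so modulo 16 there is no obstruction for m, e odd; modulo 64
the value is the non-square 48. -/
lemma quartic_ne_sq_of_emod_sixtyFour {m e N : ℤ} (h : IsCoprime m e) :
    N ^ 2 ≠ -m ^ 4 - 22 * m ^ 2 * e ^ 2 + 7 * e ^ 4 := by
  rw [show m ^ 4 = (m ^ 2) ^ 2 by ring, show e ^ 4 = (e ^ 2) ^ 2 by ring]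
  rcases h.sq_cases with ⟨i, j, hi, hj⟩ | ⟨i, j, hi, hj⟩ | ⟨i, j, hi, hj⟩ <;> rw [hi, hj]
  · convert Int.sq_ne_of_emod (n := 64) (r := 48) (N := N) (by decide) using 1
    swap
    · exact -1 - i ^ 2 - 3 * i - 22 * i * j - j + 7 * j ^ 2
    · push_cast; ring
  · convert Int.sq_ne_of_emod (n := 8) (r := -1) (N := N) (by decide) using 1
    swap
    · exact 1 - 2 * i ^ 2 - 11 * i * (8 * j + 1) + 7 * (8 * j ^ 2 + 2 * j)
    · push_cast; ring
  · convert Int.sq_ne_of_emod (n := 8) (r := -1) (N := N) (by decide) using 1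
    swap
    · exact -8 * i ^ 2 - 2 * i - 11 * j * (8 * i + 1) + 14 * j ^ 2
    · push_cast; ring

end SquareClasses

/-! ### The two halves of the 2-isogeny descent on the twists. -/

section TwistSquareClasses

lemma eq_of_prime_dvd_squarefree_part {α β D d m e N : ℤ} {q k p : ℕ} (hq : q.Prime)
    (hD : D = 1 ∨ D = -1 ∨ D = -3 ∨ D = 5)
    (hβ : β.natAbs = q ^ k)
    (h3 : ∀ u v : ZMod 3, u ^ 2 + α * u * v + β * v ^ 2 = 0 → u = 0 ∧ v = 0)
    (h5 : ∀ u v : ZMod 5, u ^ 2 + α * u * v + β * v ^ 2 = 0 → u = 0 ∧ v = 0)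
    (hd : Squarefree d) (hme : IsCoprime m e)
    (h : d * N ^ 2 = d ^ 2 * m ^ 4 + α * D * d * m ^ 2 * e ^ 2 + β * D ^ 2 * e ^ 4)
    (hp : p.Prime) (hpd : (p : ℤ) ∣ d) (hpb : (p : ℤ) ∣ β * D ^ 2) : p = q := by
  have hpZ : Prime (p : ℤ) := Nat.prime_iff_prime_int.mp hp
  rcases hpZ.dvd_or_dvd hpb with h1 | h1
  · rw [Int.natCast_dvd, hβ] at h1
    exact (Nat.prime_dvd_prime_iff_eq hp hq).mp (hp.dvd_of_dvd_pow h1)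
  · have hpD := hpZ.dvd_of_dvd_pow h1
    have hne (r : ℕ) (hr : r.Prime) (han : ∀ u v : ZMod r, u ^ 2 + α * u * v + β * v ^ 2 = 0 →
        u = 0 ∧ v = 0) (hrD : (r : ℤ) ∣ D) (hr2 : ¬ (r : ℤ) ^ 2 ∣ D) (hpr : p = r) : p = q := by
      subst hpr
      exact absurd hpd (not_dvd_of_anisotropic hp hd hme hrD hr2 han h)
    rcases hD with rfl | rfl | rfl | rfl
    · exact absurd (isUnit_of_dvd_one hpD) hpZ.not_isUnit
    · exact absurd (isUnit_of_dvd_one (by simpa using hpD)) hpZ.not_isUnit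
    · refine hne 3 Nat.prime_three h3 (by norm_num) (by norm_num) ?_
      have : p ∣ 3 := by simpa using Int.natCast_dvd.mp hpD
      exact (Nat.prime_dvd_prime_iff_eq hp Nat.prime_three).mp this
    · refine hne 5 Nat.prime_five h5 (by norm_num) (by norm_num) ?_
      have : p ∣ 5 := by simpa using Int.natCast_dvd.mp hpD
      exact (Nat.prime_dvd_prime_iff_eq hp Nat.prime_five).mp this

/-- Only the prime 2 can divide the squarefree part: the form u² - 11uv + 32v² has discriminant -7,
a non-residue modulo 3 and 5. Since -7 < 0, the quadratic factor of the cubic is positive and so is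
x. -/
lemma eq_sq_or_eq_two_mul_sq {D : ℤ} (hD : D = 1 ∨ D = -1 ∨ D = -3 ∨ D = 5) {x y : ℚ} (hx : x ≠ 0)
    (h : y ^ 2 = x ^ 3 + (-11 * D : ℤ) * x ^ 2 + (32 * D ^ 2 : ℤ) * x) :
    ∃ r : ℚ, x = r ^ 2 ∨ x = 2 * r ^ 2 := by
  obtain ⟨d, m, e, N, hd, hme, hm, he, hx', hq, hp⟩ := exists_quartic_of_rational_point hx h
  have hd1 : d.natAbs = 1 ∨ d.natAbs = 2 := by
    refine (Int.squarefree_natAbs.mpr hd).eq_one_or_eq_of_forall_prime fun p hpp hpd ↦ ?_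
    have hpd' : (p : ℤ) ∣ d := Int.natCast_dvd.mpr hpd
    exact eq_of_prime_dvd_squarefree_part (α := -11) (k := 5) Nat.prime_two hD (by norm_num)
      (by decide) (by decide) hd hme hq hpp hpd' (hp p hpp hpd')
  have hD0 : (D : ℚ) ≠ 0 := by rcases hD with rfl | rfl | rfl | rfl <;> norm_num
  have hxpos : 0 < x := by
    have h1 : 0 < x ^ 2 - 11 * D * x + 32 * D ^ 2 := by
      have : (0 : ℚ) < D ^ 2 := by positivity
      nlinarith [sq_nonneg (2 * x - 11 * D)]
    by_contra! hneg
    have : x < 0 := lt_of_le_of_ne hneg hx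
    push_cast at h
    nlinarith [sq_nonneg y]
  have hdpos : 0 < d := by
    rw [hx'] at hxpos
    have := pos_of_mul_pos_left hxpos (sq_nonneg _)
    exact_mod_cast this
  refine ⟨m / e, ?_⟩
  rw [Int.natAbs_of_nonneg hdpos.le |>.symm] at hx'
  rcases hd1 with h1 | h1 <;> rw [h1] at hx'
  · left; simpa using hx'
  · right; simpa using hx'

/-- This is the 2-isogenous curve. The form u² + 22uv - 7v² has discriminant 512, twice a square,
and 2 is a non-residue modulo 3 and 5. The classes -1 and 7 are excluded 2-adically. -/
lemma eq_sq_or_eq_neg_seven_mul_sq {D : ℤ} (hD : D = 1 ∨ D = -1 ∨ D = -3 ∨ D = 5) {x y : ℚ}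
    (hx : x ≠ 0) (h : y ^ 2 = x ^ 3 + (22 * D : ℤ) * x ^ 2 + (-7 * D ^ 2 : ℤ) * x) :
    ∃ r : ℚ, x = r ^ 2 ∨ x = -7 * r ^ 2 := by
  obtain ⟨d, m, e, N, hd, hme, hm, he, hx', hq, hp⟩ := exists_quartic_of_rational_point hx h
  have hd1 : d.natAbs = 1 ∨ d.natAbs = 7 := by
    refine (Int.squarefree_natAbs.mpr hd).eq_one_or_eq_of_forall_prime fun p hpp hpd ↦ ?_
    have hpd' : (p : ℤ) ∣ d := Int.natCast_dvd.mpr hpd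
    exact eq_of_prime_dvd_squarefree_part (α := 22) (k := 1) (by norm_num) hD (by norm_num)
      (by decide) (by decide) hd hme hq hpp hpd' (hp p hpp hpd')
  refine ⟨m / e, ?_⟩
  have hcases : d = 1 ∨ d = -1 ∨ d = 7 ∨ d = -7 := by omega
  rcases hcases with rfl | rfl | rfl | rfl
  · left; simpa using hx'
  · exfalso
    have hq' : N ^ 2 = -1 * m ^ 4 + (22 * D) * m ^ 2 * e ^ 2 + 7 * D ^ 2 * e ^ 4 := by
      linear_combination -hq
    rcases hD with rfl | rfl | rfl | rfl
    · exact quartic_ne_sq_of_emod_sixteen hme (by norm_num) (by norm_num) (by norm_num)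
        (by norm_num) hq'
    · exact quartic_ne_sq_of_emod_sixtyFour hme (by rw [hq']; ring)
    · exact quartic_ne_sq_of_emod_sixteen hme (by norm_num) (by norm_num) (by norm_num)
        (by norm_num) hq'
    · exact quartic_ne_sq_of_emod_sixteen hme (by norm_num) (by norm_num) (by norm_num)
        (by norm_num) hq'
  · exfalso
    have hq' : N ^ 2 = 7 * m ^ 4 + (22 * D) * m ^ 2 * e ^ 2 + (-D ^ 2) * e ^ 4 := by
      have : 7 * N ^ 2 = 7 * (7 * m ^ 4 + (22 * D) * m ^ 2 * e ^ 2 + (-D ^ 2) * e ^ 4) := by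
        linear_combination hq
      linarith
    rcases hD with rfl | rfl | rfl | rfl
    · exact quartic_ne_sq_of_emod_sixteen hme (by norm_num) (by norm_num) (by norm_num)
        (by norm_num) hq'
    · exact quartic_ne_sq_of_emod_sixtyFour hme.symm (by rw [hq']; ring)
    · exact quartic_ne_sq_of_emod_sixteen hme (by norm_num) (by norm_num) (by norm_num)
        (by norm_num) hq'
    · exact quartic_ne_sq_of_emod_sixteen hme (by norm_num) (by norm_num) (by norm_num)
        (by norm_num) hq'
  · right; simpa using hx'

end TwistSquareClasses

/-! ### Descent with heights: the twists have rank zero. -/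

/-- An abstract descent: if every non-torsion element is, up to torsion, twice an element of
substantially smaller height, then every element is torsion. -/
theorem AddCommGroup.isOfFinAddOrder_of_descent {A : Type*} [AddCommGroup A] (h : A → ℝ) (C : ℝ)
    (hfin : ∀ B, {P : A | h P ≤ B}.Finite)
    (hdesc : ∀ P : A, ¬ IsOfFinAddOrder P →
      ∃ R, IsOfFinAddOrder (P - 2 • R) ∧ 4 * h R ≤ C + h P) (P : A) : IsOfFinAddOrder P := by
  by_contra hP
  -- With this bound, 4 h(R) ≤ C + h(Q) ≤ 4B, so the step stays within elements of height at most B.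
  set B := max (h P) (C / 3)
  have hB : C ≤ 3 * B := by linarith [le_max_right (h P) (C / 3)]
  let S := {Q : A // ¬ IsOfFinAddOrder Q ∧ h Q ≤ B}
  have : Finite S := ((hfin B).subset fun Q hQ ↦ hQ.2).to_subtype
  have hstep (Q : S) : ∃ R : S, Q.1 - 2 • R.1 ∈ AddCommGroup.torsion A := by
    obtain ⟨R, hR, hh⟩ := hdesc Q.1 Q.2.1
    refine ⟨⟨R, fun hR' ↦ Q.2.1 ?_, by linarith [Q.2.2]⟩, hR⟩
    have : Q.1 - 2 • R + 2 • R ∈ AddCommGroup.torsion A :=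
      add_mem hR (AddSubgroup.nsmul_mem _ hR' 2)
    rwa [sub_add_cancel] at this
  choose φ hφ using hstep
  have hiter (n : ℕ) (Q : S) : Q.1 - 2 ^ n • (φ^[n] Q).1 ∈ AddCommGroup.torsion A := by
    induction n generalizing Q with
    | zero => simp
    | succ n ih =>
      have := add_mem (hφ Q) (AddSubgroup.nsmul_mem _ (ih (φ Q)) 2)
      rw [Function.iterate_succ_apply]
      convert this using 1
      rw [smul_sub, smul_smul, ← pow_succ']; abel
  -- The orbit lies in a finite set, so some Q recurs and Q - 2ᵏ⁺¹Q is torsion, which makes Q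
  -- torsion.
  obtain ⟨i, j, hij, he⟩ := Finite.exists_ne_map_eq_of_infinite fun n : ℕ ↦
    φ^[n] (⟨P, hP, le_max_left _ _⟩ : S)
  wlog hlt : i < j generalizing i j
  · exact this j i hij.symm he.symm (lt_of_le_of_ne (not_lt.mp hlt) hij.symm)
  obtain ⟨k, rfl⟩ := Nat.exists_eq_add_of_lt hlt
  set Q := φ^[i] (⟨P, hP, le_max_left _ _⟩ : S)
  have hQ : φ^[k + 1] Q = Q := by
    rw [← Function.iterate_add_apply, add_comm, ← add_assoc]; exact he.symm
  have h1 := hiter (k + 1) Q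
  rw [hQ] at h1
  have h2 : (2 ^ (k + 1) - 1) • Q.1 ∈ AddCommGroup.torsion A := by
    have h3 : (2 ^ (k + 1) - 1) • Q.1 = -(Q.1 - 2 ^ (k + 1) • Q.1) := by
      rw [neg_sub, eq_sub_iff_add_eq, ← succ_nsmul, Nat.sub_add_cancel Nat.one_le_two_pow]
    rw [h3]; exact neg_mem h1
  refine Q.2.1 ?_
  obtain ⟨n, hn, hn'⟩ := isOfFinAddOrder_iff_nsmul_eq_zero.mp h2
  refine isOfFinAddOrder_iff_nsmul_eq_zero.mpr ⟨n * (2 ^ (k + 1) - 1), ?_, ?_⟩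
  · have : 2 ≤ 2 ^ (k + 1) := by rw [pow_succ]; linarith [Nat.one_le_two_pow (n := k)]
    exact Nat.mul_pos hn (by omega)
  · rw [mul_comm, mul_nsmul]; exact hn'

namespace WeierstrassCurve.Affine

open IsTwoTorsionNF Height

section Halving

variable {F : Type*} [Field F] [DecidableEq F] {W : Affine F} [hW : IsTwoTorsionNF W]
  [W.IsElliptic]

/-- Explicit inverse of the two isogenies composing to doubling: r² = x lifts the point to the
isogenous curve, with `x`-coordinate 2r² + a₂ + 2s there, and ρ lifts it back. -/
lemma Point.exists_two_nsmul_eq {x y r s ρ : F} (h : W.Nonsingular x y) (hx : x = r ^ 2)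
    (hy : y = r * s) (hr : r ≠ 0) (hρ : ρ ≠ 0) (hρ2 : ρ ^ 2 = 2 * r ^ 2 + W.a₂ + 2 * s) :
    ∃ R : W.Point, 2 • R = some x y h := by
  have h20 := two_ne_zero_of_isTwoTorsionNF W
  have hb := a₄_ne_zero_of_isTwoTorsionNF (W := W)
  have hE := equation_iff_of_isTwoTorsionNF.mp h.1
  have hs : s ^ 2 = r ^ 4 + W.a₂ * r ^ 2 + W.a₄ := by
    apply mul_left_cancel₀ (pow_ne_zero 2 hr)
    rw [hx, hy] at hE
    linear_combination hE
  set X := r ^ 2 + s + r * ρ with hX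
  have hXX : X * (r ^ 2 + s - r * ρ) = W.a₄ := by
    rw [hX]; linear_combination hs - r ^ 2 * hρ2
  have hX0 : X ≠ 0 := fun h ↦ hb (by rw [← hXX, h, zero_mul])
  have hXE : X ^ 2 + W.a₂ * X + W.a₄ = ρ ^ 2 * X := by
    rw [← hXX]; linear_combination -X * hρ2
  have hN : W.Nonsingular X (ρ * X) := by
    rw [nonsingular_iff_of_isTwoTorsionNF]; linear_combination -X * hXE
  obtain ⟨x', y', h', e, hx'⟩ := exists_add_self hN (mul_ne_zero h20 (mul_ne_zero hρ hX0))
  have hxx : x' = x := by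
    rw [hx', hx, ← hXX]
    congr 1
    field_simp
    rw [hX]; ring
  subst hxx
  rcases X_eq_iff_of_isTwoTorsionNF h' h with rfl | hY
  · exact ⟨some _ _ hN, by rw [two_nsmul, e]⟩
  · refine ⟨-some _ _ hN, ?_⟩
    obtain ⟨h'', e''⟩ := neg_some_of_isTwoTorsionNF h'
    rw [two_nsmul, ← neg_add, e, e'']
    simp only [some.injEq, true_and]
    rw [hY, neg_neg]

end Halving

section Height

variable {K : Type*} [Field K] [NumberField K] [DecidableEq K] {W : Affine K}

/-- The naive logarithmic height of a point. -/
noncomputable def Point.naiveHeight : W.Point → ℝ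
  | .zero => 0
  | .some x _ _ => logHeight₁ x

-- Northcott's theorem for the `x`-coordinate, whose fibres are pairs {P, -P}.
omit [DecidableEq K] in
lemma Point.finite_naiveHeight_le (B : ℝ) : {P : W.Point | P.naiveHeight ≤ B}.Finite := by
  have hfin : {x : K | logHeight₁ x ≤ B}.Finite := Northcott.finite_le B
  refine (Set.Finite.preimage' (f := xRep) ((hfin.image fun x ↦ ![x, 1]).insert ![1, 0])
    fun v _ ↦ ?_).subset fun P hP ↦ ?_
  · rcases (xRep (W' := W) ⁻¹' {v}).eq_empty_or_nonempty with h | ⟨P, hP⟩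
    · rw [h]; exact Set.finite_empty
    · refine (Set.toFinite {P, -P}).subset fun Q hQ ↦ ?_
      exact xRep_eq_xRep_iff.mp (hQ.trans hP.symm)
  · cases P with
    | zero => exact Set.mem_insert _ _
    | some x y h => exact Set.mem_insert_of_mem _ ⟨x, hP, rfl⟩

variable [hW : IsTwoTorsionNF W] [W.IsElliptic]

lemma Point.exists_naiveHeight_double_ge : ∃ C, ∀ {x y x' y' : K} (h : W.Nonsingular x y)
    (h' : W.Nonsingular x' y'), some x y h + some x y h = some x' y' h' →
    4 * logHeight₁ x ≤ C + logHeight₁ x' := by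
  obtain ⟨C₁, hC₁⟩ := abs_logHeight_addSubMap_sub_two_mul_logHeight_le W
  obtain ⟨C₂, hC₂⟩ := logHeight_sym2_ge K
  refine ⟨C₁ - 2 * C₂, fun {x y x' y'} h h' e ↦ ?_⟩
  have hy : 2 * y ≠ 0 := fun hy ↦ by
    rw [add_self_eq_zero h hy] at e; exact some_ne_zero _ e.symm
  obtain ⟨x'', y'', h'', e', hx'⟩ := exists_add_self h hy
  rw [e, some.injEq] at e'
  rw [← e'.1] at hx'
  have hE := equation_iff_of_isTwoTorsionNF.mp h.1
  have h1 := hC₁ ![x * x, x * 1 + 1 * x, 1 * 1]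
  have h2 := hC₂ (a := x) (b := 1) (c := x) (d := 1) (by simp) (by simp)
  -- For P = Q the pair {P + Q, P - Q} is {2P, 0}, so the symmetric coordinates are those of x(2P)
  -- and of infinity.
  have h3 : (fun i ↦ (addSubMap W i).eval ![x * x, x * 1 + 1 * x, 1 * 1]) =
      ![(x ^ 2 - W.a₄) ^ 2, (2 * y) ^ 2, 0] := by
    funext i
    fin_cases i
    · simp [addSubMap, b₄, b₆, b₈, hW.a₁, hW.a₃, hW.a₆]; ring
    · simp [addSubMap, b₂, b₄, b₆, hW.a₁, hW.a₃, hW.a₆]; linear_combination (-4) * hE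
    · simp [addSubMap]; ring
  rw [h3, logHeight_cons_cons_cons_zero, ← logHeight₁_div_eq_logHeight, ← div_pow, ← hx'] at h1
  rw [← logHeight₁_eq_logHeight] at h2
  linarith [(abs_le.mp h1).1]

end Height

section Twist

variable {W : Affine ℚ} [hW : IsTwoTorsionNF W] [W.IsElliptic] {D : ℤ}

/-- The class of x is 1 or 2, and adding (0, 0) multiplies it by 32D², of class 2; so x may be taken
to be a square. The remaining obstruction on the isogenous curve is then a choice of sign. -/
lemma Point.exists_two_nsmul_eq_or_eq_add (hD : D = 1 ∨ D = -1 ∨ D = -3 ∨ D = 5)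
    (ha : W.a₂ = (-11 * D : ℤ)) (hb : W.a₄ = (32 * D ^ 2 : ℤ)) (P : W.Point) :
    ∃ R : W.Point, 2 • R = P ∨ 2 • R = P + twoTorsionPoint W := by
  have hD0 : (D : ℚ) ≠ 0 := by rcases hD with rfl | rfl | rfl | rfl <;> norm_num
  have key {x y : ℚ} (h : W.Nonsingular x y) (hx : x ≠ 0) {r : ℚ} (hr : x = r ^ 2) :
      ∃ R : W.Point, 2 • R = some x y h := by
    have hE := equation_iff_of_isTwoTorsionNF.mp h.1
    have hr0 : r ≠ 0 := fun h ↦ hx (by rw [hr, h]; ring)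
    set s := y / r with hs
    have hys : y = r * s := by rw [hs]; field_simp
    have hs2 : s ^ 2 = r ^ 4 + W.a₂ * r ^ 2 + W.a₄ := by
      apply mul_left_cancel₀ (pow_ne_zero 2 hr0)
      rw [hr, hys] at hE
      linear_combination hE
    set X := 2 * r ^ 2 + W.a₂ + 2 * s with hX
    have hXX : X * (2 * r ^ 2 + W.a₂ - 2 * s) = -7 * D ^ 2 := by
      have : X * (2 * r ^ 2 + W.a₂ - 2 * s) = W.a₂ ^ 2 - 4 * W.a₄ := by
        rw [hX]; linear_combination -4 * hs2
      rw [this, ha, hb]; push_cast; ring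
    have hX0 : X ≠ 0 := fun h ↦ by
      rw [h, zero_mul] at hXX
      exact mul_ne_zero (by norm_num) (pow_ne_zero 2 hD0) hXX.symm
    have hXE : (2 * r * X) ^ 2 = X ^ 3 + (22 * D : ℤ) * X ^ 2 + (-7 * D ^ 2 : ℤ) * X := by
      have h1 : ((22 * D : ℤ) : ℚ) = -2 * W.a₂ := by rw [ha]; push_cast; ring
      have h2 : ((-7 * D ^ 2 : ℤ) : ℚ) = W.a₂ ^ 2 - 4 * W.a₄ := by rw [ha, hb]; push_cast; ring
      rw [h1, h2, hX]
      linear_combination (-4 * (2 * r ^ 2 + W.a₂ + 2 * s)) * hs2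
    obtain ⟨ρ, h1 | h1⟩ := eq_sq_or_eq_neg_seven_mul_sq hD hX0 hXE
    · refine exists_two_nsmul_eq h hr hys hr0 (ρ := ρ) (fun h ↦ hX0 (by rw [h1, h]; ring)) ?_
      rw [← h1]
    -- Changing the signs of r and s replaces X by -7D²/X, which is the square (D/ρ)² when X = -7ρ².
    · have hρ0 : ρ ≠ 0 := fun h ↦ hX0 (by rw [h1, h]; ring)
      refine exists_two_nsmul_eq h (r := -r) (s := -s) (ρ := D / ρ) (by rw [hr]; ring)
        (by rw [hys]; ring) (neg_ne_zero.mpr hr0) (div_ne_zero hD0 hρ0) ?_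
      rw [h1] at hXX
      field_simp
      linear_combination (1 / 7 : ℚ) * hXX
  cases P with
  | zero => exact ⟨0, .inl ((two_nsmul _).trans (_root_.add_zero _))⟩
  | some x y h =>
    have hE := equation_iff_of_isTwoTorsionNF.mp h.1
    by_cases hx : x = 0
    · refine ⟨0, .inr ?_⟩
      have hy : y = 0 := by rw [hx] at hE; simpa using hE
      subst hx hy
      rw [two_nsmul, _root_.add_zero]
      exact (twoTorsionPoint_add_self (W := W)).symm
    · have hE' := hE
      rw [ha, hb] at hE'
      obtain ⟨r, hr | hr⟩ := eq_sq_or_eq_two_mul_sq hD hx hE'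
      · obtain ⟨R, hR⟩ := key h hx hr
        exact ⟨R, .inl hR⟩
      · have hr0 : r ≠ 0 := fun h ↦ hx (by rw [hr, h]; ring)
        obtain ⟨x', y', h', e, hx'⟩ := exists_add_twoTorsionPoint h hx
        have hx0 : x' ≠ 0 := by
          rw [hx']; exact div_ne_zero a₄_ne_zero_of_isTwoTorsionNF hx
        obtain ⟨R, hR⟩ := key h' hx0 (r := 4 * D / r) (by
          rw [hx', hr, hb]; push_cast; field_simp; ring)
        exact ⟨R, .inr (hR.trans e.symm)⟩

/-- The quadratic twists of `y² = x³ - 11x² + 32x` by `1`, `-1`, `-3` and `5` have rank zero. -/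
theorem isOfFinAddOrder_of_twist (hD : D = 1 ∨ D = -1 ∨ D = -3 ∨ D = 5)
    (ha : W.a₂ = (-11 * D : ℤ)) (hb : W.a₄ = (32 * D ^ 2 : ℤ)) (P : W.Point) :
    IsOfFinAddOrder P := by
  obtain ⟨C, hC⟩ := Point.exists_naiveHeight_double_ge (W := W)
  -- The extra term `logHeight₁ W.a₄` pays for adding (0, 0), which sends x to a₄/x.
  refine AddCommGroup.isOfFinAddOrder_of_descent Point.naiveHeight
    (C + logHeight₁ W.a₄) Point.finite_naiveHeight_le (fun P hP ↦ ?_) P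
  have hT : IsOfFinAddOrder (twoTorsionPoint W) :=
    isOfFinAddOrder_iff_nsmul_eq_zero.mpr
      ⟨2, two_pos, by rw [two_nsmul, twoTorsionPoint_add_self]⟩
  have h0 : IsOfFinAddOrder (0 : W.Point) := IsOfFinAddOrder.zero
  have hdouble (R : W.Point) (hR : ¬ IsOfFinAddOrder (2 • R)) :
      4 * R.naiveHeight ≤ C + (2 • R).naiveHeight := by
    rw [two_nsmul] at hR ⊢
    cases R with
    | zero => exact absurd h0 hR
    | some x y h =>
      cases hQ : Point.some x y h + Point.some x y h with
      | zero => rw [hQ] at hR; exact absurd h0 hR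
      | some x' y' h' => exact hC h h' hQ
  obtain ⟨R, hR | hR⟩ := Point.exists_two_nsmul_eq_or_eq_add hD ha hb P
  · refine ⟨R, by rw [hR, sub_self]; exact h0, ?_⟩
    have := hdouble R (by rwa [hR])
    rw [hR] at this
    linarith [zero_le_logHeight₁ W.a₄]
  · have hPT : ¬ IsOfFinAddOrder (P + twoTorsionPoint W) := fun h ↦ by
      refine hP ?_
      have := (AddCommGroup.torsion W.Point).sub_mem h hT
      rwa [add_sub_cancel_right] at this
    refine ⟨R, ?_, ?_⟩
    · rw [hR, sub_add_cancel_left]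
      exact (AddCommGroup.torsion W.Point).neg_mem hT
    · have h1 := hdouble R (by rwa [hR])
      rw [hR] at h1
      cases P with
      | zero => exact absurd h0 hP
      | some x y h =>
        have hx : x ≠ 0 := by
          rintro rfl
          have hy : y = 0 := by
            have hE := equation_iff_of_isTwoTorsionNF.mp h.1
            simpa using hE
          subst hy
          exact hP hT
        obtain ⟨x', y', h', e, hx'⟩ := exists_add_twoTorsionPoint h hx
        rw [e] at h1
        have h2 : logHeight₁ x' ≤ logHeight₁ W.a₄ + logHeight₁ x := by
          rw [hx', div_eq_mul_inv, ← logHeight₁_inv x]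
          exact logHeight₁_mul_le _ _
        change 4 * R.naiveHeight ≤ C + logHeight₁ x' at h1
        change 4 * R.naiveHeight ≤ _ + logHeight₁ x
        linarith

end Twist

end WeierstrassCurve.Affine

/-! ### Rational points of X₁(14) and of its twists. -/

lemma padicResidue_intCast {F : Type*} [Field F] {p : ℕ} [Fact p.Prime] (f : F →+* ℚ_[p]) {z : F}
    (n : ℤ) (hz : z = n) (h : z ∈ padicIntegers f) : padicResidue f ⟨z, h⟩ = n := by
  subst hz
  exact map_intCast (padicResidue f) n

namespace WeierstrassCurve.Affine

open IsTwoTorsionNF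

section TwoTorsion

variable {F : Type*} [Field F] [DecidableEq F] {W : Affine F} [hW : IsTwoTorsionNF W]
  [W.IsElliptic]

lemma eq_zero_or_eq_twoTorsionPoint (hd : ∀ z : F, z ^ 2 ≠ W.a₂ ^ 2 - 4 * W.a₄) {P : W.Point}
    (hP : 2 • P = 0) : P = 0 ∨ P = twoTorsionPoint W := by
  cases P with
  | zero => exact .inl rfl
  | some x y h =>
    right
    have h20 := two_ne_zero_of_isTwoTorsionNF W
    have hy : y = 0 := by
      by_contra hy
      obtain ⟨x', y', h', e, -⟩ := Point.exists_add_self h (mul_ne_zero h20 hy)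
      rw [two_nsmul, e] at hP
      exact Point.some_ne_zero _ hP
    have hE := equation_iff_of_isTwoTorsionNF.mp h.1
    have hx : x = 0 := by
      by_contra hx
      refine hd (2 * x + W.a₂) ?_
      apply mul_left_cancel₀ hx
      rw [hy] at hE
      linear_combination -4 * hE
    subst hx hy
    rfl

lemma two_nsmul_ne_twoTorsionPoint (hb : ∀ z : F, z ^ 2 ≠ W.a₄) (P : W.Point) :
    2 • P ≠ twoTorsionPoint W := by
  intro hP
  cases P with
  | zero =>
    refine twoTorsionPoint_ne_zero (W := W) (hP.symm.trans ?_)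
    exact (two_nsmul _).trans (_root_.add_zero _)
  | some x y h =>
    rw [two_nsmul] at hP
    by_cases hy : 2 * y = 0
    · rw [Point.add_self_eq_zero h hy] at hP
      exact twoTorsionPoint_ne_zero (W := W) hP.symm
    · obtain ⟨x', y', h', e, hx'⟩ := Point.exists_add_self h hy
      rw [e, twoTorsionPoint, Point.some.injEq] at hP
      rw [hP.1] at hx'
      have := (div_eq_zero_iff.mp (pow_eq_zero_iff two_ne_zero |>.mp hx'.symm)).resolve_right hy
      exact hb x (by linear_combination this)

end TwoTorsion

section Twist

variable {W : Affine ℚ} [hW : IsTwoTorsionNF W] [W.IsElliptic] {D : ℤ}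

lemma finite_and_card_le_of_twist (p : ℕ) [Fact p.Prime] (hp : p ≠ 2)
    (hD : D = 1 ∨ D = -1 ∨ D = -3 ∨ D = 5)
    (ha : W.a₂ = (-11 * D : ℤ)) (hb : W.a₄ = (32 * D ^ 2 : ℤ))
    (hb0 : ((32 * D ^ 2 : ℤ) : ZMod p) ≠ 0)
    (hd : ((-11 * D : ℤ) : ZMod p) ^ 2 - 4 * ((32 * D ^ 2 : ℤ) : ZMod p) ≠ 0) :
    Finite W.Point ∧ Nat.card W.Point ≤ (Finset.univ.filter fun z : ZMod p × ZMod p ↦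
        z.2 ^ 2 = z.1 ^ 3 + ((-11 * D : ℤ) : ZMod p) * z.1 ^ 2 +
          ((32 * D ^ 2 : ℤ) : ZMod p) * z.1).card + 1 := by
  have ham : W.a₂ ∈ padicIntegers (algebraMap ℚ ℚ_[p]) := by rw [ha]; exact intCast_mem _ _
  have hbm : W.a₄ ∈ padicIntegers (algebraMap ℚ ℚ_[p]) := by rw [hb]; exact intCast_mem _ _
  obtain ⟨h1, h2⟩ := card_torsion_le hp ham hbm (padicResidue_intCast _ _ ha ham)
    (padicResidue_intCast _ _ hb hbm) hb0 hd
  have htop : AddCommGroup.torsion W.Point = ⊤ := by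
    rw [eq_top_iff]
    exact fun P _ ↦ isOfFinAddOrder_of_twist hD ha hb P
  rw [htop] at h1 h2
  refine ⟨Finite.of_equiv _ AddSubgroup.topEquiv.toEquiv, ?_⟩
  rwa [Nat.card_congr AddSubgroup.topEquiv.toEquiv] at h2

omit hW [W.IsElliptic] in
lemma Point.eq_of_card_le {P : W.Point} (S : Finset W.Point) (hfin : Finite W.Point)
    (h : Nat.card W.Point ≤ S.card) : P ∈ S := by
  have := Fintype.ofFinite W.Point
  rw [Nat.card_eq_fintype_card] at h
  have := Finset.eq_univ_of_card S (le_antisymm (Finset.card_le_univ S) h)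
  rw [this]; exact Finset.mem_univ _

instance fact_prime_five : Fact (Nat.Prime 5) := ⟨Nat.prime_five⟩

/-- The rational points of `y² = x³ - 11x² + 32x` are `6`-torsion, with `x ∈ {0, 4, 8}`. -/
lemma rational_points (ha : W.a₂ = -11) (hb : W.a₄ = 32) (P : W.Point) :
    6 • P = 0 ∧ ∀ x y h, P = .some x y h → x = 0 ∨ x = 4 ∨ x = 8 := by
  classical
  obtain ⟨hfin, hcard⟩ := finite_and_card_le_of_twist (W := W) (D := 1) 3 (by norm_num) (.inl rfl)
    (by rw [ha]; norm_num) (by rw [hb]; norm_num) (by decide) (by decide)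
  have hcard6 : Nat.card W.Point ≤ 6 := hcard.trans (by decide)
  have hN {x y : ℚ} (h : y ^ 2 = x ^ 3 + -11 * x ^ 2 + 32 * x) : W.Nonsingular x y := by
    rw [nonsingular_iff_of_isTwoTorsionNF, ha, hb]; exact h
  let S : Finset W.Point := {0, .some 0 0 (hN (by norm_num)), .some 4 4 (hN (by norm_num)),
    .some 4 (-4) (hN (by norm_num)), .some 8 8 (hN (by norm_num)), .some 8 (-8) (hN (by norm_num))}
  have hS : S.card = 6 := by
    simp only [S]
    repeat rw [Finset.card_insert_of_notMem (by
      simp only [Finset.mem_insert, Finset.mem_singleton, Point.some.injEq, not_or,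
        reduceCtorEq, not_false_eq_true, true_and, and_true]
      try norm_num)]
    simp
  have hle : Nat.card W.Point ≤ S.card := by rw [hS]; exact hcard6
  have hmem (Q : W.Point) : Q ∈ S := Point.eq_of_card_le S hfin hle
  constructor
  · have hcard' : Nat.card W.Point = 6 := by
      have := Fintype.ofFinite W.Point
      refine le_antisymm hcard6 ?_
      rw [Nat.card_eq_fintype_card, ← hS]; exact Finset.card_le_univ S
    rw [← hcard']; exact card_nsmul_eq_zero'
  · rintro x y h rfl
    have := hmem (.some x y h)
    simp only [S, Finset.mem_insert, Finset.mem_singleton, Point.some.injEq,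
      reduceCtorEq, false_or] at this
    rcases this with h | h | h | h | h <;> simp [h.1]

lemma eq_zero_or_eq_twoTorsionPoint_of_card_le (hfin : Finite W.Point)
    (hcard : Nat.card W.Point ≤ 2) (P : W.Point) : P = 0 ∨ P = twoTorsionPoint W := by
  classical
  have h : P ∈ ({0, twoTorsionPoint W} : Finset W.Point) := by
    refine Point.eq_of_card_le _ hfin ?_
    rwa [Finset.card_pair (twoTorsionPoint_ne_zero (W := W)).symm]
  simpa using h

omit [W.IsElliptic] in
-- The 3-division polynomial has the root -12, where the cubic is negative, and a cubic factor that
-- has no rational root because it has none modulo 13.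
lemma eq_zero_of_three_nsmul_eq_zero (ha : W.a₂ = 33) (hb : W.a₄ = 288) {P : W.Point} (hP : 3 • P = 0) :
    P = 0 := by
  cases P with
  | zero => rfl
  | some x y h =>
    exfalso
    have hE := equation_iff_of_isTwoTorsionNF.mp h.1
    have h2 : Point.some x y h + .some x y h = -.some x y h := by
      rw [eq_neg_iff_add_eq_zero, ← two_nsmul, ← succ_nsmul]; exact hP
    obtain ⟨h', e'⟩ := Point.neg_some_of_isTwoTorsionNF h
    by_cases hy : 2 * y = 0
    · rw [Point.add_self_eq_zero h hy, e'] at h2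
      exact Point.some_ne_zero _ h2.symm
    obtain ⟨x', y', h'', e, hx'⟩ := Point.exists_add_self h hy
    rw [e, e', Point.some.injEq] at h2
    rw [h2.1, eq_comm, div_pow, div_eq_iff (pow_ne_zero 2 hy), mul_pow, hE, ha, hb] at hx'
    rw [ha, hb] at hE
    have hfac : (x + 12) * (x ^ 3 + 32 * x ^ 2 + 192 * x - 2304) = 0 := by
      linear_combination (-1 / 3 : ℚ) * hx'
    rcases mul_eq_zero.mp hfac with h12 | hg
    · obtain rfl : x = -12 := by linarith
      norm_num at hE
      nlinarith [sq_nonneg y]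
    · set z := x / 4 with hz
      have hz' : z ^ 3 + 8 * z ^ 2 + 12 * z - 36 = 0 := by
        rw [hz]; linear_combination (1 / 64 : ℚ) * hg
      have hden : (z.den : ℚ) ≠ 0 := by exact_mod_cast z.den_ne_zero
      have hint : z.num ^ 3 + 8 * z.num ^ 2 * z.den + 12 * z.num * z.den ^ 2 -
          36 * (z.den : ℤ) ^ 3 = 0 := by
        have : (z.num : ℚ) ^ 3 + 8 * z.num ^ 2 * z.den + 12 * z.num * z.den ^ 2 -
            36 * (z.den : ℚ) ^ 3 = 0 := by
          have hzn : (z.num : ℚ) = z * z.den := (Rat.mul_den_eq_num z).symm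
          rw [hzn]; linear_combination (z.den : ℚ) ^ 3 * hz'
        exact_mod_cast this
      have hmod : ∀ u v : ZMod 13, u ^ 3 + 8 * u ^ 2 * v + 12 * u * v ^ 2 - 36 * v ^ 3 = 0 →
          u = 0 ∧ v = 0 := by decide
      have hint' := congr_arg (Int.cast : ℤ → ZMod 13) hint
      push_cast at hint'
      obtain ⟨h1, h2⟩ := hmod _ _ hint'
      have h1' := (ZMod.intCast_zmod_eq_zero_iff_dvd z.num 13).mp h1
      have h2' := (ZMod.natCast_eq_zero_iff z.den 13).mp h2
      have := Nat.dvd_gcd (Int.natCast_dvd.mp h1') h2'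
      rw [z.reduced.gcd_eq_one] at this
      norm_num at this

/-- The quadratic twists of `y² = x³ - 11x² + 32x` by `-1`, `-3` and `5` have no rational
points besides `0` and `(0, 0)`. -/
lemma eq_zero_or_eq_twoTorsionPoint_of_twist (hD : D = -1 ∨ D = -3 ∨ D = 5)
    (ha : W.a₂ = (-11 * D : ℤ)) (hb : W.a₄ = (32 * D ^ 2 : ℤ)) (P : W.Point) :
    P = 0 ∨ P = twoTorsionPoint W := by
  rcases hD with rfl | rfl | rfl
  · obtain ⟨hfin, hcard⟩ := finite_and_card_le_of_twist 3 (by norm_num) (by norm_num) ha hb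
      (by decide) (by decide)
    exact eq_zero_or_eq_twoTorsionPoint_of_card_le hfin (hcard.trans (by decide)) P
  -- The twist by -3 has bad reduction at 3, and modulo 5 the bound is only 6. The orders 4 and 6
  -- are excluded by 2-torsion, halving of (0, 0) and 3-torsion.
  · obtain ⟨hfin, hcard⟩ := finite_and_card_le_of_twist 5 (by norm_num) (by norm_num) ha hb
      (by decide) (by decide)
    have hcard6 : Nat.card W.Point ≤ 6 := hcard.trans (by decide)
    norm_num at ha hb
    have hd (z : ℚ) : z ^ 2 ≠ W.a₂ ^ 2 - 4 * W.a₄ := by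
      rw [ha, hb]; nlinarith [sq_nonneg z]
    have hb' (z : ℚ) : z ^ 2 ≠ W.a₄ := by
      rw [hb]
      intro h
      have : IsSquare (288 : ℚ) := ⟨z, by rw [← h]; ring⟩
      revert this
      decide +kernel
    have h2dvd : 2 ∣ Nat.card W.Point := by
      have : addOrderOf (twoTorsionPoint W) = 2 :=
        addOrderOf_eq_prime (by rw [two_nsmul, twoTorsionPoint_add_self]) twoTorsionPoint_ne_zero
      rw [← this]; exact addOrderOf_dvd_natCard _
    have hpos : 0 < Nat.card W.Point := Nat.card_pos
    have hP : Nat.card W.Point • P = 0 := card_nsmul_eq_zero'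
    have hcases : Nat.card W.Point = 2 ∨ Nat.card W.Point = 4 ∨ Nat.card W.Point = 6 := by omega
    rcases hcases with h | h | h <;> rw [h] at hP
    · exact eq_zero_or_eq_twoTorsionPoint hd hP
    · rw [show 4 = 2 * 2 by norm_num, mul_nsmul] at hP
      rcases eq_zero_or_eq_twoTorsionPoint hd hP with h | h
      · exact eq_zero_or_eq_twoTorsionPoint hd h
      · exact absurd h (two_nsmul_ne_twoTorsionPoint hb' P)
    · rw [show 6 = 2 * 3 by norm_num, mul_nsmul] at hP
      exact eq_zero_or_eq_twoTorsionPoint hd (eq_zero_of_three_nsmul_eq_zero ha hb hP)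
  · obtain ⟨hfin, hcard⟩ := finite_and_card_le_of_twist 3 (by norm_num) (by norm_num) ha hb
      (by decide) (by decide)
    exact eq_zero_or_eq_twoTorsionPoint_of_card_le hfin (hcard.trans (by decide)) P

end Twist

end WeierstrassCurve.Affine

/-! ### Points of X₁(14) over the three smaller quadratic fields. -/

namespace WeierstrassCurve.Affine

open IsTwoTorsionNF

/-- The quadratic twist by `D` of the modular curve `X₁(14)`. -/
def twistX₁14 (D : ℤ) : WeierstrassCurve ℚ := ⟨0, (-11 * D : ℤ), 0, (32 * D ^ 2 : ℤ), 0⟩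

instance (D : ℤ) : IsTwoTorsionNF (twistX₁14 D) := ⟨rfl, rfl, rfl⟩

instance {R A : Type*} [CommRing R] [CommRing A] [Algebra R A] (W : WeierstrassCurve R)
    [IsTwoTorsionNF W] : IsTwoTorsionNF (W.baseChange A) :=
  inferInstanceAs (IsTwoTorsionNF (W.map (algebraMap R A)))

instance {R A : Type*} [CommRing R] [CommRing A] [Algebra R A] (W : WeierstrassCurve R)
    [W.IsElliptic] : (W.baseChange A).IsElliptic :=
  inferInstanceAs (W.map (algebraMap R A)).IsElliptic

lemma isElliptic_twistX₁14 {D : ℤ} (hD : D ≠ 0) : (twistX₁14 D).IsElliptic := by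
  constructor
  rw [isUnit_iff_ne_zero, Δ_of_isTwoTorsionNF, twistX₁14]
  have : (D : ℚ) ≠ 0 := by exact_mod_cast hD
  have h : (16 : ℚ) * ((32 * D ^ 2 : ℤ) : ℚ) ^ 2 *
      (((-11 * D : ℤ) : ℚ) ^ 2 - 4 * ((32 * D ^ 2 : ℤ) : ℚ)) = -114688 * D ^ 6 := by
    push_cast; ring
  rw [h]
  exact mul_ne_zero (by norm_num) (pow_ne_zero _ this)

instance : (twistX₁14 1).IsElliptic := isElliptic_twistX₁14 one_ne_zero

section QuadraticField

variable {K : Type*} [Field K] [Algebra ℚ K] {D : ℤ} {δ : K} {σ : K →ₐ[ℚ] K}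

lemma map_twoTorsionPoint [DecidableEq K] (W : WeierstrassCurve ℚ) [IsTwoTorsionNF W] [W.IsElliptic] :
    Point.map (W' := W) σ (twoTorsionPoint (W.baseChange K)) = twoTorsionPoint (W.baseChange K) := by
  simp only [twoTorsionPoint, Point.map_some, map_zero]

lemma exists_rational_of_map_eq_self [DecidableEq K] (W : WeierstrassCurve ℚ)
    (hfix : ∀ z, σ z = z → ∃ q : ℚ, z = q) {P : (W.baseChange K).toAffine.Point}
    (hP : Point.map (W' := W) σ P = P) :
    ∃ Q : (W.baseChange ℚ).toAffine.Point, Point.map (W' := W) (Algebra.ofId ℚ K) Q = P := by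
  rcases P with _ | ⟨x, y, h⟩
  · exact ⟨0, map_zero _⟩
  · rw [Point.map_some, Point.some.injEq] at hP
    obtain ⟨a, rfl⟩ := hfix _ hP.1
    obtain ⟨b, rfl⟩ := hfix _ hP.2
    have e (q : ℚ) : (q : K) = Algebra.ofId ℚ K q := by simp
    refine ⟨.some a b ?_, ?_⟩
    · rw [e a, e b] at h
      exact (baseChange_nonsingular W (f := Algebra.ofId ℚ K) (Algebra.ofId ℚ K).injective a b).mp h
    · rw [Point.map_some, Point.some.injEq]
      exact ⟨(e a).symm, (e b).symm⟩

variable [CharZero K]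

/-- A square root of a rational number is either fixed or negated by σ; in the second case its
product with δ is rational. -/
lemma sq_ne_of_twist (hδ : δ ^ 2 = D) (hσ : σ δ = -δ) (hfix : ∀ z, σ z = z → ∃ q : ℚ, z = q)
    {c : ℤ} (hc : ¬ IsSquare (c : ℚ)) (hcD : ¬ IsSquare (c * D : ℚ)) (z : K) : z ^ 2 ≠ c := by
  intro hz
  have h : (σ z) ^ 2 = z ^ 2 := by rw [← map_pow, hz, map_intCast]
  rcases sq_eq_sq_iff_eq_or_eq_neg.mp h with h | h
  · obtain ⟨q, rfl⟩ := hfix z h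
    exact hc ⟨q, by rw [← sq]; exact_mod_cast hz.symm⟩
  · obtain ⟨q, hq⟩ := hfix (z * δ) (by rw [map_mul, h, hσ]; ring)
    refine hcD ⟨q, ?_⟩
    have : ((c * D : ℚ) : K) = ((q * q : ℚ) : K) := by
      push_cast
      rw [← hq, ← hz, ← hδ]; ring
    exact_mod_cast this

lemma equation_baseChange_twistX₁14 {x y : K} :
    ((twistX₁14 D).baseChange K).toAffine.Equation x y ↔
      y ^ 2 = x ^ 3 - 11 * D * x ^ 2 + 32 * D ^ 2 * x := by
  rw [equation_iff_of_isTwoTorsionNF]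
  simp [twistX₁14, sub_eq_add_neg]

variable [DecidableEq K]

/-- Anti-invariance makes x and yδ rational, and (Dx, Dyδ) is a rational point of the twist by D. -/
lemma eq_zero_or_eq_twoTorsionPoint_of_map_eq_neg (hD : D = -1 ∨ D = -3 ∨ D = 5)
    (hδ : δ ^ 2 = D) (hσ : σ δ = -δ) (hfix : ∀ z, σ z = z → ∃ q : ℚ, z = q)
    {P : ((twistX₁14 1).baseChange K).toAffine.Point}
    (hP : Point.map (W' := twistX₁14 1) σ P = -P) :
    P = 0 ∨ P = twoTorsionPoint ((twistX₁14 1).baseChange K) := by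
  have hDQ : (D : ℚ) ≠ 0 := by rcases hD with rfl | rfl | rfl <;> norm_num
  have hDK : (D : K) ≠ 0 := by exact_mod_cast hDQ
  have hδ0 : δ ≠ 0 := fun h ↦ hDK (by rw [← hδ, h]; ring)
  have : (twistX₁14 D).IsElliptic := isElliptic_twistX₁14 (by exact_mod_cast hDQ)
  rcases P with _ | ⟨x, y, h⟩
  · exact .inl rfl
  obtain ⟨h', e⟩ := Point.neg_some_of_isTwoTorsionNF h
  rw [e, Point.map_some, Point.some.injEq] at hP
  obtain ⟨q, rfl⟩ := hfix _ hP.1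
  obtain ⟨r, hr⟩ := hfix (y * δ) (by rw [map_mul, hP.2, hσ]; ring)
  have heq := equation_baseChange_twistX₁14.mp h.1
  have hQ : (D * r) ^ 2 = (D * q) ^ 3 - 11 * D * (D * q) ^ 2 + 32 * D ^ 2 * (D * q) := by
    have : (((D * r) ^ 2 : ℚ) : K) =
        (((D * q) ^ 3 - 11 * D * (D * q) ^ 2 + 32 * D ^ 2 * (D * q) : ℚ) : K) := by
      push_cast
      rw [← hr, mul_pow, mul_pow, hδ, heq]
      push_cast
      ring
    exact_mod_cast this
  have hns : (twistX₁14 D).toAffine.Nonsingular (D * q) (D * r) := by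
    refine equation_iff_nonsingular.mp ?_
    rw [equation_iff_of_isTwoTorsionNF, hQ, twistX₁14]
    push_cast
    ring
  right
  have hT := (eq_zero_or_eq_twoTorsionPoint_of_twist (W := twistX₁14 D) hD rfl rfl
    (.some _ _ hns)).resolve_left (Point.some_ne_zero _)
  rw [twoTorsionPoint, Point.some.injEq] at hT
  have hq := (mul_eq_zero.mp hT.1).resolve_left hDQ
  have hr0 := (mul_eq_zero.mp hT.2).resolve_left hDQ
  rw [hr0, Rat.cast_zero] at hr
  rw [twoTorsionPoint, Point.some.injEq]
  exact ⟨by rw [hq, Rat.cast_zero], (mul_eq_zero.mp hr).resolve_right hδ0⟩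

/-- The points of `y² = x³ - 11x² + 32x` over `ℚ(i)`, `ℚ(√-3)` and `ℚ(√5)` are rational. -/
theorem x_eq_of_quadratic_field (hD : D = -1 ∨ D = -3 ∨ D = 5) (hδ : δ ^ 2 = D) (hσ : σ δ = -δ)
    (hσσ : ∀ z, σ (σ z) = z) (hfix : ∀ z, σ z = z → ∃ q : ℚ, z = q) {x y : K}
    (h : y ^ 2 = x ^ 3 - 11 * x ^ 2 + 32 * x) : x = 0 ∨ x = 4 ∨ x = 8 := by
  set W := (twistX₁14 1).baseChange K with hW
  have ha : W.a₂ = -11 := by simp [W, twistX₁14]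
  have hb : W.a₄ = 32 := by simp [W, twistX₁14]
  let s : W.toAffine.Point →+ W.toAffine.Point := Point.map (W' := twistX₁14 1) σ
  have hanti (P : W.toAffine.Point) (hP : s P = -P) : P = 0 ∨ P = twoTorsionPoint W :=
    eq_zero_or_eq_twoTorsionPoint_of_map_eq_neg hD hδ hσ hfix hP
  have hrat (P : W.toAffine.Point) (hP : s P = P) :
      6 • P = 0 ∧ ∀ x y h, P = .some x y h → x = 0 ∨ x = 4 ∨ x = 8 := by
    obtain ⟨Q, hQ⟩ := exists_rational_of_map_eq_self _ hfix hP
    obtain ⟨h6, hx⟩ := rational_points (W := (twistX₁14 1).baseChange ℚ)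
      (by simp [twistX₁14]) (by simp [twistX₁14]) Q
    rw [← hQ]
    refine ⟨by rw [← map_nsmul, h6, map_zero], fun x y h e ↦ ?_⟩
    rcases Q with _ | ⟨a, b, h'⟩
    · exact absurd e.symm (Point.some_ne_zero _)
    · rw [Point.map_some, Point.some.injEq] at e
      rw [← e.1]
      rcases hx a b h' rfl with rfl | rfl | rfl <;> simp
  have hss (Q : W.toAffine.Point) : s (s Q) = Q := by
    rcases Q with _ | ⟨x, y, h⟩
    · exact (congr_arg s (map_zero s)).trans (map_zero s)
    · change Point.map (W' := twistX₁14 1) σ (Point.map (W' := twistX₁14 1) σ (.some x y h)) = _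
      rw [Point.map_some, Point.map_some, Point.some.injEq]
      exact ⟨hσσ x, hσσ y⟩
  have hns : W.toAffine.Nonsingular x y := equation_iff_nonsingular.mp
    (equation_baseChange_twistX₁14.mpr (by push_cast; linear_combination h))
  let P : W.toAffine.Point := .some x y hns
  rcases hanti (P - s P) (by rw [map_sub, hss]; abel) with h0 | hT
  · exact (hrat P (sub_eq_zero.mp h0).symm).2 x y _ rfl
  · exfalso
    have hd (z : K) : z ^ 2 ≠ W.a₂ ^ 2 - 4 * W.a₄ := by
      have := sq_ne_of_twist hδ hσ hfix (c := -7)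
        (by decide +kernel) (by rcases hD with rfl | rfl | rfl <;> decide +kernel) z
      rw [ha, hb]
      convert this using 1
      norm_num
    have h32 (z : K) : z ^ 2 ≠ W.a₄ := by
      have := sq_ne_of_twist hδ hσ hfix (c := 32)
        (by decide +kernel) (by rcases hD with rfl | rfl | rfl <;> decide +kernel) z
      rw [hb]
      exact_mod_cast this
    have hsT : s (twoTorsionPoint W) = twoTorsionPoint W := map_twoTorsionPoint _
    have hT2 : 2 • twoTorsionPoint W = 0 := by rw [two_nsmul, twoTorsionPoint_add_self]
    have h6 := (hrat (P + s P) (by rw [map_add, hss, add_comm])).1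
    -- The case P - σP = T: then 3P is killed by 4, and the only such points are 0 and T, as -7 and
    -- 32 are not squares in K. Both are fixed by σ, against 3P - σ(3P) = T.
    have h12 : 2 • 2 • 3 • P = 0 := by
      have : 2 • 2 • 3 • P = 6 • (P + s P) + 3 • 2 • (P - s P) := by abel
      rw [this, h6, hT, hT2, smul_zero, add_zero]
    have h3 : 3 • P - s (3 • P) = twoTorsionPoint W := by
      rw [map_nsmul, ← nsmul_sub, hT, show 3 = 2 + 1 from rfl, add_nsmul, hT2, one_nsmul, zero_add]
    rcases eq_zero_or_eq_twoTorsionPoint hd h12 with h | h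
    · rcases eq_zero_or_eq_twoTorsionPoint hd h with h | h
      · rw [h, map_zero, sub_zero] at h3
        exact twoTorsionPoint_ne_zero h3.symm
      · rw [h, hsT, sub_self] at h3
        exact twoTorsionPoint_ne_zero h3.symm
    · exact two_nsmul_ne_twoTorsionPoint h32 _ h

end QuadraticField

end WeierstrassCurve.Affine

/-! ### From a point of order 14 to a point of X₁(14). -/

section Lines

variable {K : Type*} [Field K] {u v w δ ℓ α α' Y₁ Y₂ Y₃ : K}

/-- Eliminating the three slopes gives the cubic times δu + v, and that factor is nonzero because u²
≠ v². -/
lemma cubic_relation_of_lines (hu : u ≠ 0) (hv : v ≠ 0) (hw : w ≠ 0) (hδ : δ ^ 2 = 1)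
    (huv : u ^ 2 ≠ v ^ 2) (h₁ : Y₁ = ℓ * u ^ 2 + δ * u * v * w)
    (h₂ : Y₂ = ℓ * v ^ 2 + δ * u * v * w) (h₃ : Y₃ = ℓ * w ^ 2 + δ * u * v * w)
    (h₄ : Y₁ = α * u ^ 2 + u ^ 2 * v) (h₅ : -Y₂ = α * v ^ 2 + u ^ 2 * v)
    (h₆ : Y₂ = α' * v ^ 2 + v ^ 2 * w) (h₇ : -Y₃ = α' * w ^ 2 + v ^ 2 * w) :
    -u * v ^ 2 + δ * u ^ 2 * w - u * v * w + δ * v * w ^ 2 = 0 := by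
  have e₁ : ℓ * u + δ * v * w - α * u - u * v = 0 :=
    (mul_eq_zero.mp (by linear_combination h₄ - h₁ :
      u * (ℓ * u + δ * v * w - α * u - u * v) = 0)).resolve_left hu
  have e₂ : ℓ * v + δ * u * w + α * v + u ^ 2 = 0 :=
    (mul_eq_zero.mp (by linear_combination -h₅ - h₂ :
      v * (ℓ * v + δ * u * w + α * v + u ^ 2) = 0)).resolve_left hv
  have e₃ : ℓ * v + δ * u * w - α' * v - v * w = 0 :=
    (mul_eq_zero.mp (by linear_combination h₆ - h₂ :
      v * (ℓ * v + δ * u * w - α' * v - v * w) = 0)).resolve_left hv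
  have e₄ : ℓ * w + δ * u * v + α' * w + v ^ 2 = 0 :=
    (mul_eq_zero.mp (by linear_combination -h₇ - h₃ :
      w * (ℓ * w + δ * u * v + α' * w + v ^ 2) = 0)).resolve_left hw
  have hprod : (δ * u + v) * (-u * v ^ 2 + δ * u ^ 2 * w - u * v * w + δ * v * w ^ 2) = 0 := by
    linear_combination w * (v * e₁ + u * e₂) - u * (w * e₃ + v * e₄) +
      (u ^ 3 * w + u * v * w ^ 2) * hδ
  refine (mul_eq_zero.mp hprod).resolve_left fun h ↦ huv ?_
  linear_combination (δ * u - v) * h - u ^ 2 * hδ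

/-- If three points of a curve `Y² = X³ + AX² + BX` form a cyclic subgroup of order seven together
with their negatives and zero, they define a point of the modular curve `X₁(14)`. The hypotheses say
that the tangent lines at `Pᵢ` pass through `-Pᵢ₊₁`, and that the three points are collinear. -/
lemma exists_of_tangent_lines {X₁ X₂ X₃ α₁ α₂ α₃ β₁ β₂ β₃ m : K} (h2 : (2 : K) ≠ 0)
    (hX₁ : X₁ ≠ 0) (hX₂ : X₂ ≠ 0) (hX₃ : X₃ ≠ 0) (h₁₂ : X₁ ≠ X₂) (h₂₃ : X₂ ≠ X₃)
    (hY₁ : Y₁ = α₁ * X₁ + β₁) (hY₂ : -Y₂ = α₁ * X₂ + β₁) (hβ₁ : X₁ * X₁ * X₂ = β₁ ^ 2)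
    (hY₂' : Y₂ = α₂ * X₂ + β₂) (hY₃ : -Y₃ = α₂ * X₃ + β₂) (hβ₂ : X₂ * X₂ * X₃ = β₂ ^ 2)
    (hY₃' : Y₃ = α₃ * X₃ + β₃) (hY₁' : -Y₁ = α₃ * X₁ + β₃) (hβ₃ : X₃ * X₃ * X₁ = β₃ ^ 2)
    (hL₁ : Y₁ = ℓ * X₁ + m) (hL₂ : Y₂ = ℓ * X₂ + m) (hL₃ : Y₃ = ℓ * X₃ + m)
    (hm : X₁ * X₂ * X₃ = m ^ 2) :
    ∃ x y : K, y ^ 2 = x ^ 3 - 11 * x ^ 2 + 32 * x ∧ x ≠ 0 ∧ x ≠ 4 ∧ x ≠ 8 := by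
  obtain ⟨u, hu⟩ : ∃ u, u = β₃ / X₃ := ⟨_, rfl⟩
  obtain ⟨v, hv⟩ : ∃ v, v = β₁ / X₁ := ⟨_, rfl⟩
  obtain ⟨w, hw⟩ : ∃ w, w = β₂ / X₂ := ⟨_, rfl⟩
  obtain rfl : β₃ = X₃ * u := by rw [hu, mul_div_cancel₀ _ hX₃]
  obtain rfl : β₁ = X₁ * v := by rw [hv, mul_div_cancel₀ _ hX₁]
  obtain rfl : β₂ = X₂ * w := by rw [hw, mul_div_cancel₀ _ hX₂]
  obtain rfl : X₁ = u ^ 2 :=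
    mul_left_cancel₀ (mul_ne_zero hX₃ hX₃) (by linear_combination hβ₃)
  obtain rfl : X₂ = v ^ 2 :=
    mul_left_cancel₀ (mul_ne_zero hX₁ hX₁) (by linear_combination hβ₁)
  obtain rfl : X₃ = w ^ 2 :=
    mul_left_cancel₀ (mul_ne_zero hX₂ hX₂) (by linear_combination hβ₂)
  clear hu hv hw hβ₁ hβ₂ hβ₃
  have hu : u ≠ 0 := fun h ↦ hX₁ (by rw [h]; ring)
  have hv : v ≠ 0 := fun h ↦ hX₂ (by rw [h]; ring)
  have hw : w ≠ 0 := fun h ↦ hX₃ (by rw [h]; ring)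
  have hm' : m ^ 2 = (u * v * w) ^ 2 := by rw [← hm]; ring
  -- For m = uvw, two cyclic permutations of the cubic relation add up to 2uw(u - v) = 0, a
  -- contradiction. For m = -uvw the cubic is a plane model of X₁(14).
  rcases sq_eq_sq_iff_eq_or_eq_neg.mp hm' with rfl | rfl
  · have c₁ := cubic_relation_of_lines (δ := 1) hu hv hw (by ring) h₁₂ (by rw [hL₁]; ring)
      (by rw [hL₂]; ring) (by rw [hL₃]; ring) hY₁ hY₂ hY₂' hY₃
    have c₂ := cubic_relation_of_lines (δ := 1) hv hw hu (by ring) h₂₃ (by rw [hL₂]; ring)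
      (by rw [hL₃]; ring) (by rw [hL₁]; ring) hY₂' hY₃ hY₃' hY₁'
    have : 2 * u * w * (u - v) = 0 := by linear_combination c₁ + c₂
    have huv : u - v = 0 := (mul_eq_zero.mp this).resolve_left (mul_ne_zero (mul_ne_zero h2 hu) hw)
    exact absurd (by rw [sub_eq_zero.mp huv]) h₁₂
  · have c := cubic_relation_of_lines (δ := -1) hu hv hw (by ring) h₁₂ (by rw [hL₁]; ring)
      (by rw [hL₂]; ring) (by rw [hL₃]; ring) hY₁ hY₂ hY₂' hY₃
    have h4 : (4 : K) ≠ 0 := by rw [show (4 : K) = 2 * 2 by norm_num]; exact mul_ne_zero h2 h2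
    have huv : u - v ≠ 0 := fun h ↦ h₁₂ (by rw [sub_eq_zero.mp h])
    -- The cubic is quadratic in w; completing the square gives a Weierstrass equation in v/u. The
    -- values x = 0, 4, 8 mean v = u, v = 0, v = -u.
    refine ⟨4 * (1 - v / u), 4 * (2 * v * w + u ^ 2 + u * v) / u ^ 2, ?_, fun h ↦ huv ?_,
      fun h ↦ hv ?_, fun h ↦ h₁₂ ?_⟩
    · field_simp
      linear_combination -16 * v * c
    · field_simp at h
      exact mul_left_cancel₀ h4 (by linear_combination h)
    · field_simp at h
      linear_combination -h
    · have : u + v = 0 := by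
        field_simp at h
        exact mul_left_cancel₀ h4 (by linear_combination -h)
      linear_combination (u - v) * this

end Lines

namespace WeierstrassCurve.Affine

variable {K : Type*} [Field K] {W : Affine K}

lemma Point.eq_or_eq_neg_of_X_eq {x₁ y₁ x₂ y₂ : K} {h₁ : W.Nonsingular x₁ y₁}
    {h₂ : W.Nonsingular x₂ y₂} (h : x₁ = x₂) :
    some x₁ y₁ h₁ = some x₂ y₂ h₂ ∨ some x₁ y₁ h₁ = -some x₂ y₂ h₂ := by
  subst h
  rcases Y_eq_of_X_eq h₁.1 h₂.1 rfl with rfl | rfl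
  · exact .inl rfl
  · exact .inr (by rw [neg_some])

variable [DecidableEq K]

/-- The line through three points of sum zero, in coordinates in which a given point of order two
is the origin and negation is `Y ↦ -Y`. -/
lemma Point.exists_line_of_twoTorsion (h2 : (2 : K) ≠ 0) {x₀ y₀ : K} (h₀ : W.Equation x₀ y₀)
    (hT : 2 * y₀ + W.a₁ * x₀ + W.a₃ = 0) {x₁ y₁ x₂ y₂ x₃ y₃ : K} {h₁ : W.Nonsingular x₁ y₁}
    {h₂ : W.Nonsingular x₂ y₂} {h₃ : W.Nonsingular x₃ y₃}
    (h : some x₁ y₁ h₁ + some x₂ y₂ h₂ = some x₃ y₃ h₃) :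
    ∃ α β : K, y₁ + (W.a₁ * x₁ + W.a₃) / 2 = α * (x₁ - x₀) + β ∧
      y₂ + (W.a₁ * x₂ + W.a₃) / 2 = α * (x₂ - x₀) + β ∧
      -(y₃ + (W.a₁ * x₃ + W.a₃) / 2) = α * (x₃ - x₀) + β ∧
      (x₁ - x₀) * (x₂ - x₀) * (x₃ - x₀) = β ^ 2 := by
  obtain ⟨ℓ, m, e₁, e₂, e₃, e⟩ := Point.exists_line h
  rw [equation_iff] at h₀
  rw [negY] at e₃
  have ha : W.a₃ = -(2 * y₀ + W.a₁ * x₀) := by linear_combination hT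
  refine ⟨ℓ + W.a₁ / 2, ℓ * x₀ + m - y₀, ?_, ?_, ?_, ?_⟩
  · rw [e₁, ha]; field_simp; ring
  · rw [e₂, ha]; field_simp; ring
  · rw [show y₃ = -(ℓ * x₃ + m) - W.a₁ * x₃ - W.a₃ by linear_combination -e₃, ha]
    field_simp; ring
  · have := e x₀
    rw [ha] at this h₀
    linear_combination -this + h₀

/-- A point of order `14` on an elliptic curve defines a non-cuspidal point of `X₁(14)`. -/
theorem exists_point_of_addOrderOf_eq (h2 : (2 : K) ≠ 0) {g : W.Point} (hg : addOrderOf g = 14) :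
    ∃ x y : K, y ^ 2 = x ^ 3 - 11 * x ^ 2 + 32 * x ∧ x ≠ 0 ∧ x ≠ 4 ∧ x ≠ 8 := by
  have hne (n : ℕ) (hn : ¬ 14 ∣ n) : n • g ≠ 0 := fun h ↦
    hn (hg ▸ addOrderOf_dvd_of_nsmul_eq_zero h)
  have h14 : 14 • g = 0 := hg ▸ addOrderOf_nsmul_eq_zero g
  -- The point 7g of order two is the origin. The points 2g, 4g, 8g are permuted cyclically by
  -- doubling, as 16g = 2g, and are collinear, as 2 + 4 + 8 = 14.
  obtain ⟨x₀, y₀, h₀, e₀⟩ : ∃ x y h, 7 • g = .some x y h := by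
    rcases h : 7 • g with _ | ⟨x, y, h'⟩
    · exact absurd h (hne 7 (by norm_num))
    · exact ⟨x, y, h', rfl⟩
  obtain ⟨x₁, y₁, h₁, e₁⟩ : ∃ x y h, 2 • g = .some x y h := by
    rcases h : 2 • g with _ | ⟨x, y, h'⟩
    · exact absurd h (hne 2 (by norm_num))
    · exact ⟨x, y, h', rfl⟩
  obtain ⟨x₂, y₂, h₂, e₂⟩ : ∃ x y h, 4 • g = .some x y h := by
    rcases h : 4 • g with _ | ⟨x, y, h'⟩
    · exact absurd h (hne 4 (by norm_num))
    · exact ⟨x, y, h', rfl⟩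
  obtain ⟨x₃, y₃, h₃, e₃⟩ : ∃ x y h, 8 • g = .some x y h := by
    rcases h : 8 • g with _ | ⟨x, y, h'⟩
    · exact absurd h (hne 8 (by norm_num))
    · exact ⟨x, y, h', rfl⟩
  have hsub {a b : ℕ} {x y x' y' : K} {h : W.Nonsingular x y} {h' : W.Nonsingular x' y'}
      (e : a • g = .some x y h) (e' : b • g = .some x' y' h') (hab : ¬ 14 ∣ a + b)
      (hab' : ¬ (14 : ℤ) ∣ a - b) : x - x' ≠ 0 := by
    intro hx
    rcases Point.eq_or_eq_neg_of_X_eq (h₁ := h) (h₂ := h') (sub_eq_zero.mp hx) with H | H <;>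
      rw [← e, ← e'] at H
    · refine hab' ?_
      rw [← sub_eq_zero, ← natCast_zsmul, ← natCast_zsmul, ← sub_smul] at H
      have := addOrderOf_dvd_iff_zsmul_eq_zero.mpr H
      rwa [hg] at this
    · exact hne (a + b) hab (by rw [add_nsmul, H, neg_add_cancel])
  have hT : 2 * y₀ + W.a₁ * x₀ + W.a₃ = 0 := by
    have : Point.some x₀ y₀ h₀ = -Point.some x₀ y₀ h₀ := by
      rw [← e₀, eq_neg_iff_add_eq_zero, ← add_nsmul, ← h14]
    rw [Point.neg_some, Point.some.injEq, negY] at this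
    linear_combination this.2
  have d₁ : Point.some x₁ y₁ h₁ + .some x₁ y₁ h₁ = .some x₂ y₂ h₂ := by
    rw [← e₁, ← e₂, ← add_nsmul]
  have d₂ : Point.some x₂ y₂ h₂ + .some x₂ y₂ h₂ = .some x₃ y₃ h₃ := by
    rw [← e₂, ← e₃, ← add_nsmul]
  have d₃ : Point.some x₃ y₃ h₃ + .some x₃ y₃ h₃ = .some x₁ y₁ h₁ := by
    rw [← e₃, ← e₁, ← add_nsmul, show 8 + 8 = 14 + 2 from rfl, add_nsmul, h14, zero_add]
  have d₄ : Point.some x₁ y₁ h₁ + .some x₂ y₂ h₂ = -.some x₃ y₃ h₃ := by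
    rw [← e₁, ← e₂, ← e₃, eq_neg_iff_add_eq_zero, ← add_nsmul, ← add_nsmul,
      ← h14]
  rw [Point.neg_some] at d₄
  obtain ⟨α₁, β₁, hY₁, -, hY₂, hβ₁⟩ := Point.exists_line_of_twoTorsion h2 h₀.1 hT d₁
  obtain ⟨α₂, β₂, hY₂', -, hY₃, hβ₂⟩ := Point.exists_line_of_twoTorsion h2 h₀.1 hT d₂
  obtain ⟨α₃, β₃, hY₃', -, hY₁', hβ₃⟩ := Point.exists_line_of_twoTorsion h2 h₀.1 hT d₃
  obtain ⟨ℓ, m, hL₁, hL₂, hL₃, hm⟩ := Point.exists_line_of_twoTorsion h2 h₀.1 hT d₄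
  have hL₃' : y₃ + (W.a₁ * x₃ + W.a₃) / 2 = ℓ * (x₃ - x₀) + m := by
    rw [← hL₃, negY]; field_simp; ring
  refine exists_of_tangent_lines h2 (hsub e₁ e₀ ?_ ?_) (hsub e₂ e₀ ?_ ?_) (hsub e₃ e₀ ?_ ?_)
    (fun h ↦ hsub e₁ e₂ ?_ ?_ (by linear_combination h))
    (fun h ↦ hsub e₂ e₃ ?_ ?_ (by linear_combination h))
    hY₁ hY₂ hβ₁ hY₂' hY₃ hβ₂ hY₃' hY₁' hβ₃ hL₁ hL₂ hL₃' hm <;> decide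

end WeierstrassCurve.Affine

/-! ### A curve over ℚ(√-7) with torsion ℤ/14ℤ. -/

instance fact_prime_eleven : Fact (Nat.Prime 11) := ⟨by norm_num⟩

/-- Hensel's lemma at 2, where X² + 7 takes the value 11 and has derivative 4. -/
lemma exists_sq_eq_neg_seven : ∃ z : ℚ_[11], z ^ 2 = -7 := by
  have h : ‖(Polynomial.X ^ 2 + 7 : Polynomial ℤ_[11]).aeval (2 : ℤ_[11])‖ <
      ‖(Polynomial.X ^ 2 + 7 : Polynomial ℤ_[11]).derivative.aeval (2 : ℤ_[11])‖ ^ 2 := by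
    have h1 : ‖(11 : ℤ_[11])‖ < 1 := by
      simpa using (PadicInt.norm_int_lt_one_iff_dvd (p := 11) 11).mpr (by norm_num)
    have h2 : ‖(4 : ℤ_[11])‖ = 1 := by
      have := (PadicInt.norm_int_lt_one_iff_dvd (p := 11) 4).not.mpr (by norm_num)
      exact le_antisymm (PadicInt.norm_le_one _) (by simpa using this)
    have e1 : (Polynomial.X ^ 2 + 7 : Polynomial ℤ_[11]).aeval (2 : ℤ_[11]) = 11 := by
      simp; norm_num
    have e2 : (Polynomial.X ^ 2 + 7 : Polynomial ℤ_[11]).derivative.aeval (2 : ℤ_[11]) = 4 := by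
      simp; norm_num
    rw [e1, e2, h2]
    simpa using h1
  obtain ⟨z, hz, -⟩ := hensels_lemma h
  refine ⟨z, ?_⟩
  have : z ^ 2 + 7 = 0 := by simpa using hz
  have := congr_arg ((↑) : ℤ_[11] → ℚ_[11]) this
  rw [PadicInt.coe_add, PadicInt.coe_pow, PadicInt.coe_zero] at this
  exact eq_neg_of_add_eq_zero_left this

namespace WeierstrassCurve

/-- An elliptic curve over a field containing `s = √-7`, with a rational point of order `14`. -/
def curve14 {K : Type*} [Field K] (s : K) : WeierstrassCurve K :=
  ⟨0, -14 + 22 * s, 0, 2048 * (-7 + 5 * s), 0⟩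

instance {K : Type*} [Field K] (s : K) : IsTwoTorsionNF (curve14 s) := ⟨rfl, rfl, rfl⟩

namespace Affine

open IsTwoTorsionNF

variable {K : Type*} [Field K] [CharZero K] {s : K}

lemma add_mul_ne_zero_of_sq_eq (hs : s ^ 2 = -7) {m n : ℤ} (h : m ^ 2 + 7 * n ^ 2 ≠ 0) :
    m + n * s ≠ 0 := by
  intro h'
  have : ((m ^ 2 + 7 * n ^ 2 : ℤ) : K) = 0 := by
    push_cast
    linear_combination (m - n * s) * h' + n ^ 2 * hs
  exact h (by exact_mod_cast this)

lemma isElliptic_curve14 (hs : s ^ 2 = -7) : (curve14 s).IsElliptic := by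
  constructor
  rw [isUnit_iff_ne_zero, Δ_of_isTwoTorsionNF, curve14]
  have h1 := add_mul_ne_zero_of_sq_eq hs (m := -7) (n := 5) (by norm_num)
  have h2 := add_mul_ne_zero_of_sq_eq hs (m := 54152) (n := -41576) (by norm_num)
  push_cast at h1 h2
  refine mul_ne_zero (mul_ne_zero (by norm_num) (pow_ne_zero _ (mul_ne_zero (by norm_num) h1)))
    fun h ↦ h2 ?_
  linear_combination h - 484 * hs

variable [DecidableEq K]

lemma card_torsion_curve14_le (hs : s ^ 2 = -7) (f : K →+* ℚ_[11]) :
    Finite (AddCommGroup.torsion (curve14 s).toAffine.Point) ∧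
      Nat.card (AddCommGroup.torsion (curve14 s).toAffine.Point) ≤ 14 := by
  have : (curve14 s).IsElliptic := isElliptic_curve14 hs
  have hmem : s ∈ padicIntegers f := by
    rw [mem_padicIntegers]
    have : ‖f s‖ ^ 2 ≤ 1 := by
      rw [← norm_pow, ← map_pow, hs, map_neg, map_ofNat]
      simpa using Padic.norm_int_le_one (p := 11) (-7)
    exact (sq_le_one_iff₀ (norm_nonneg _)).mp this
  let t : padicIntegers f := ⟨s, hmem⟩
  have ht : t ^ 2 = -7 := Subtype.ext hs
  have hr : padicResidue f t ^ 2 = -7 := by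
    rw [← map_pow, ht, map_neg, map_ofNat]
  have hA : padicResidue f (-14 + 22 * t) = -14 + 22 * padicResidue f t := by
    simp only [map_add, map_mul, map_neg, map_ofNat]
  have hB : padicResidue f (2048 * (-7 + 5 * t)) = 2048 * (-7 + 5 * padicResidue f t) := by
    simp only [map_add, map_mul, map_neg, map_ofNat]
  generalize padicResidue f t = r at hr hA hB
  -- The embedding may send s to either root of -7, so points are counted on both reductions modulo
  -- 11.
  have hr' : r = 2 ∨ r = -2 := by clear hA hB; revert r; decide
  have key := card_torsion_le (W := curve14 s) (f := f) (by norm_num) (-14 + 22 * t).2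
    (2048 * (-7 + 5 * t)).2 hA hB
  rcases hr' with rfl | rfl
  · obtain ⟨h1, h2⟩ := key (by decide) (by decide)
    exact ⟨h1, h2.trans (by decide +kernel)⟩
  · obtain ⟨h1, h2⟩ := key (by decide) (by decide)
    exact ⟨h1, h2.trans (by decide +kernel)⟩

/-- The curve corresponds to the point ((11 + s)/2, 0) of order two on X₁(14). Doubling three times
returns to the `x`-coordinate of P, so 8P = ±P. The sign is left open; order 9 is excluded later,
since 18 exceeds the bound 14 on the torsion. -/
lemma exists_nsmul_eq_zero_curve14 (hs : s ^ 2 = -7) [(curve14 s).IsElliptic] :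
    ∃ P : (curve14 s).toAffine.Point, P ≠ 0 ∧ 3 • P ≠ 0 ∧ (7 • P = 0 ∨ 9 • P = 0) := by
  have ne {m n : ℤ} (h : m ^ 2 + 7 * n ^ 2 ≠ 0) := add_mul_ne_zero_of_sq_eq hs h
  have ha : (curve14 s).a₂ = -14 + 22 * s := rfl
  have hb : (curve14 s).a₄ = 2048 * (-7 + 5 * s) := rfl
  have hns : (curve14 s).toAffine.Nonsingular (32 - 96 * s) (1024 * (3 + s)) := by
    refine equation_iff_nonsingular.mp (equation_iff_of_isTwoTorsionNF.mpr ?_)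
    rw [ha, hb]
    linear_combination (1411072 + 681984 * s) * hs
  have h1 : 2 * (1024 * (3 + s)) ≠ 0 := by
    have := ne (m := 3) (n := 1) (by norm_num)
    push_cast at this
    rw [one_mul] at this
    exact mul_ne_zero two_ne_zero (mul_ne_zero (by norm_num) this)
  obtain ⟨x₂, y₂, hns₂, e₂, hx₂⟩ := Point.exists_add_self hns h1
  obtain rfl : x₂ = 64 := by
    rw [hx₂, hb, div_pow, div_eq_iff (pow_ne_zero 2 h1)]
    have : (32 - 96 * s) ^ 2 - 2048 * (-7 + 5 * s) = -8 * (2 * (1024 * (3 + s))) := by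
      linear_combination 9216 * hs
    rw [this]; ring
  have hy₂ : y₂ ^ 2 = 4096 * (182 * s - 174) := by
    rw [equation_iff_of_isTwoTorsionNF.mp hns₂.1, ha, hb]; ring
  have h2 : 2 * y₂ ≠ 0 := by
    refine mul_ne_zero two_ne_zero fun h ↦ ne (m := -174) (n := 182) (by norm_num) ?_
    rw [h] at hy₂
    push_cast
    linear_combination -(1 / 4096) * hy₂
  obtain ⟨x₃, y₃, hns₃, e₃, hx₃⟩ := Point.exists_add_self hns₂ h2
  obtain rfl : x₃ = 32 * (s - 3) := by
    rw [hx₃, hb, div_pow, div_eq_iff (pow_ne_zero 2 h2), mul_pow, hy₂]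
    linear_combination 9437184 * hs
  have hy₃ : y₃ ^ 2 = 65536 * (18 - 10 * s) := by
    rw [equation_iff_of_isTwoTorsionNF.mp hns₃.1, ha, hb]
    linear_combination (-116736 + 55296 * s) * hs
  have h3 : 2 * y₃ ≠ 0 := by
    refine mul_ne_zero two_ne_zero fun h ↦ ne (m := 18) (n := -10) (by norm_num) ?_
    rw [h] at hy₃
    push_cast
    linear_combination -(1 / 65536) * hy₃
  obtain ⟨x₄, y₄, hns₄, e₄, hx₄⟩ := Point.exists_add_self hns₃ h3
  have hx₄' : x₄ = 32 - 96 * s := by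
    rw [hx₄, hb, div_pow, div_eq_iff (pow_ne_zero 2 h3), mul_pow 2 y₃, hy₃]
    linear_combination (57671680 - 33554432 * s + 1048576 * s ^ 2) * hs
  set P : (curve14 s).toAffine.Point := .some _ _ hns
  have e8 : 8 • P = .some x₄ y₄ hns₄ := by
    rw [← e₄, ← e₃, ← e₂]; abel
  refine ⟨P, Point.some_ne_zero _, fun h ↦ ?_, ?_⟩
  · have : P + P = -P := by rw [eq_neg_iff_add_eq_zero, ← h]; abel
    obtain ⟨h', e⟩ := Point.neg_some_of_isTwoTorsionNF hns
    rw [e₂, e, Point.some.injEq] at this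
    refine ne (m := 32) (n := 96) (by norm_num) ?_
    push_cast
    linear_combination this.1
  · rcases Point.eq_or_eq_neg_of_X_eq (h₁ := hns₄) (h₂ := hns) hx₄' with h | h <;> rw [← e8] at h
    · left
      rw [show 8 = 7 + 1 from rfl, succ_nsmul] at h
      exact left_eq_add.mp (by rw [add_comm]; exact h.symm)
    · right
      rw [show 9 = 8 + 1 from rfl, succ_nsmul]
      exact eq_neg_iff_add_eq_zero.mp h

/-- If `√-7 ∈ K` and `K` embeds in `ℚ₁₁`, then `ℤ/14ℤ` is a torsion group over `K`. -/
theorem nonempty_torsion_curve14_equiv (hs : s ^ 2 = -7) (f : K →+* ℚ_[11]) :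
    Nonempty (AddCommGroup.torsion (curve14 s).toAffine.Point ≃+ ZMod 14) := by
  have : (curve14 s).IsElliptic := isElliptic_curve14 hs
  obtain ⟨hfin, hcard⟩ := card_torsion_curve14_le hs f
  set G := AddCommGroup.torsion (curve14 s).toAffine.Point
  obtain ⟨P, hP0, hP3, hP⟩ := exists_nsmul_eq_zero_curve14 hs
  have hT : addOrderOf (twoTorsionPoint (curve14 s)) = 2 :=
    addOrderOf_eq_prime (by rw [two_nsmul, twoTorsionPoint_add_self]) twoTorsionPoint_ne_zero
  have hmem {Q : (curve14 s).toAffine.Point} {n : ℕ} (hn : 0 < n) (h : n • Q = 0) : Q ∈ G :=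
    isOfFinAddOrder_iff_nsmul_eq_zero.mpr ⟨n, hn, h⟩
  have hdvd {Q : (curve14 s).toAffine.Point} (hQ : Q ∈ G) : addOrderOf Q ∣ Nat.card G := by
    have := addOrderOf_dvd_natCard (⟨Q, hQ⟩ : G)
    rwa [← AddSubgroup.addOrderOf_coe] at this
  have hpos : 0 < Nat.card G := Nat.card_pos
  have hGT : 2 ∣ Nat.card G := by
    rw [← hT]
    exact hdvd (hmem two_pos (by rw [two_nsmul, twoTorsionPoint_add_self]))
  have h7 : addOrderOf P = 7 := by
    rcases hP with h | h
    · have : Fact (Nat.Prime 7) := ⟨by norm_num⟩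
      exact addOrderOf_eq_prime h hP0
    · exfalso
      have : addOrderOf P = 3 ^ (1 + 1) := by
        have : Fact (Nat.Prime 3) := ⟨by norm_num⟩
        exact addOrderOf_eq_prime_pow (by simpa using hP3) (by simpa using h)
      have h9 := hdvd (hmem (by norm_num) h)
      rw [this] at h9
      omega
  have hadd : addOrderOf (P + twoTorsionPoint (curve14 s)) = 14 := by
    rw [(AddCommute.all _ _).addOrderOf_add_eq_mul_addOrderOf_of_coprime, h7, hT]
    rw [h7, hT]; norm_num
  have hg : P + twoTorsionPoint (curve14 s) ∈ G :=
    hmem (n := 14) (by norm_num) (hadd ▸ addOrderOf_nsmul_eq_zero _)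
  have hc : Nat.card G = 14 := by
    refine le_antisymm hcard (Nat.le_of_dvd hpos ?_)
    rw [← hadd]; exact hdvd hg
  have hcyc : IsAddCyclic G := isAddCyclic_of_addOrderOf_eq_card ⟨_, hg⟩ (by
    rw [hc, ← AddSubgroup.addOrderOf_coe, hadd])
  exact ⟨(hc ▸ zmodAddCyclicAddEquiv hcyc).symm⟩

end Affine

end WeierstrassCurve

/-! ### Conjugation and discriminants of quadratic fields. -/

namespace NumberField

variable (K : Type*) [Field K] [NumberField K]

section Conjugation

variable [Algebra.IsQuadraticExtension ℚ K]

/-- The nontrivial automorphism of a quadratic field. -/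
lemma exists_conjugation_of_isQuadraticExtension :
    ∃ σ : K →ₐ[ℚ] K, (∃ z, σ z ≠ z) ∧ (∀ z, σ (σ z) = z) ∧
      (∀ z, σ z = z → ∃ q : ℚ, z = q) ∧
      ∀ z, ((Algebra.trace ℚ K z : ℚ) : K) = z + σ z := by
  have hcard : Nat.card (K ≃ₐ[ℚ] K) = 2 := by
    rw [IsGalois.card_aut_eq_finrank, Algebra.IsQuadraticExtension.finrank_eq_two]
  obtain ⟨σ, hσ, huniv⟩ := (Nat.card_eq_two_iff' (1 : K ≃ₐ[ℚ] K)).mp hcard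
  have hall (g : K ≃ₐ[ℚ] K) : g = 1 ∨ g = σ := or_iff_not_imp_left.mpr (huniv g)
  refine ⟨σ, ?_, fun z ↦ ?_, fun z hz ↦ ?_, fun z ↦ ?_⟩
  · by_contra! h
    exact hσ (AlgEquiv.ext h)
  · have : σ * σ = 1 := (hall (σ * σ)).resolve_right fun h ↦ hσ (mul_eq_left.mp h)
    exact DFunLike.congr_fun this z
  · obtain ⟨q, hq⟩ := (IsGalois.mem_range_algebraMap_iff_fixed z).mpr fun g ↦ by
      rcases hall g with rfl | rfl
      · rfl
      · exact hz
    exact ⟨q, by rw [← hq, eq_ratCast]⟩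
  · rw [← eq_ratCast (algebraMap ℚ K), trace_eq_sum_automorphisms]
    classical
    have : (Finset.univ : Finset (K ≃ₐ[ℚ] K)) = {1, σ} := by
      ext g; simpa using hall g
    rw [this, Finset.sum_pair hσ.symm]
    rfl

variable {K} in
lemma exists_integralBasis_of_isQuadraticExtension {σ : K →ₐ[ℚ] K}
    (htr : ∀ z, ((Algebra.trace ℚ K z : ℚ) : K) = z + σ z) :
    ∃ a b : 𝓞 K, (discr K : K) = (a * σ b - b * σ a) ^ 2 ∧
      ∀ z : 𝓞 K, ∃ m n : ℤ, (z : K) = m * a + n * b := by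
  have hcard : Fintype.card (Module.Free.ChooseBasisIndex ℤ (𝓞 K)) = Fintype.card (Fin 2) := by
    rw [← Module.finrank_eq_card_chooseBasisIndex, RingOfIntegers.rank,
      Algebra.IsQuadraticExtension.finrank_eq_two, Fintype.card_fin]
  let e := Fintype.equivOfCardEq hcard
  refine ⟨RingOfIntegers.basis K (e.symm 0), RingOfIntegers.basis K (e.symm 1), ?_, fun z ↦ ?_⟩
  · have h : (discr K : ℚ) = Algebra.discr ℚ (integralBasis K ∘ e.symm) := by
      rw [coe_discr, Algebra.discr_reindex]
    rw [Algebra.discr_def, Matrix.det_fin_two] at h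
    simp only [Algebra.traceMatrix_apply, Algebra.traceForm_apply, Function.comp_apply,
      integralBasis_apply] at h
    have h' := congr_arg (Rat.cast : ℚ → K) h
    simp only [Rat.cast_intCast, Rat.cast_sub, Rat.cast_mul, htr, map_mul] at h'
    rw [h']
    ring
  · have := (RingOfIntegers.basis K).sum_repr z
    rw [← e.symm.sum_comp, Fin.sum_univ_two] at this
    refine ⟨(RingOfIntegers.basis K).repr z (e.symm 0), (RingOfIntegers.basis K).repr z (e.symm 1),
      ?_⟩
    simpa using (congr_arg (algebraMap (𝓞 K) K) this).symm

/-- The discriminant of a quadratic field is the square of an element `δ` with `δ^σ = -δ`, and is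
congruent to `0` or `1` modulo `4`. -/
lemma exists_sq_eq_discr {σ : K →ₐ[ℚ] K} (hσσ : ∀ z, σ (σ z) = z)
    (hfix : ∀ z, σ z = z → ∃ q : ℚ, z = q)
    (htr : ∀ z, ((Algebra.trace ℚ K z : ℚ) : K) = z + σ z) :
    ∃ δ : K, δ ^ 2 = discr K ∧ σ δ = -δ ∧ (discr K % 4 = 0 ∨ discr K % 4 = 1) := by
  obtain ⟨a, b, h, -⟩ := exists_integralBasis_of_isQuadraticExtension htr
  have hint (z : K) (hz : IsIntegral ℤ z) (hf : σ z = z) : ∃ n : ℤ, z = n := by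
    obtain ⟨q, rfl⟩ := hfix z hf
    have : IsIntegral ℤ q := by
      rw [← eq_ratCast (algebraMap ℚ K)] at hz
      exact (isIntegral_algebraMap_iff (algebraMap ℚ K).injective).mp hz
    obtain ⟨n, rfl⟩ := IsIntegrallyClosed.isIntegral_iff.mp this
    exact ⟨n, by simp⟩
  have hab : IsIntegral ℤ ((a : K) * σ b) :=
    (RingOfIntegers.isIntegral_coe a).mul 
      ((RingOfIntegers.isIntegral_coe b).map (σ.restrictScalars ℤ))
  have hab' : IsIntegral ℤ (σ ((a : K) * σ b)) := hab.map (σ.restrictScalars ℤ)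
  obtain ⟨t, ht⟩ := hint _ (hab.add hab') (by simp only [map_add, map_mul, hσσ]; ring)
  obtain ⟨n, hn⟩ := hint _ (hab.mul hab') (by simp only [map_mul, hσσ]; ring)
  refine ⟨_, h.symm, by simp only [map_sub, map_mul, hσσ]; ring, ?_⟩
  -- Stickelberger's argument: t and n are the trace and norm of aσ(b), and (z - σz)² = t² - 4n.
  have hd : discr K = t ^ 2 - 4 * n := by
    have : (discr K : K) = ((t ^ 2 - 4 * n : ℤ) : K) := by
      push_cast
      rw [h, ← ht, ← hn]
      simp only [map_mul, hσσ]
      ring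
    exact_mod_cast this
  rw [hd]
  rcases Int.even_or_odd' t with ⟨k, rfl | rfl⟩ <;> ring_nf <;> omega

/-- A quadratic field of discriminant at most `7` in absolute value is `ℚ(i)`, `ℚ(√-3)`, `ℚ(√5)`
or `ℚ(√-7)`. -/
lemma discr_eq_of_abs_le_seven (h : |discr K| ≤ 7) :
    discr K = -3 ∨ discr K = -4 ∨ discr K = 5 ∨ discr K = -7 := by
  obtain ⟨σ, -, hσσ, hfix, htr⟩ := exists_conjugation_of_isQuadraticExtension K
  obtain ⟨δ, hδ, hσδ, hmod⟩ := exists_sq_eq_discr K hσσ hfix htr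
  have hsq (m : ℤ) : discr K ≠ m ^ 2 := by
    intro hm
    rw [hm, Int.cast_pow] at hδ
    have hσδ' : σ δ = δ := by
      rcases sq_eq_sq_iff_eq_or_eq_neg.mp hδ with rfl | rfl <;> simp
    have hδ0 : δ = 0 := by
      rw [hσδ'] at hσδ
      exact self_eq_neg.mp hσδ
    rw [hδ0, zero_pow two_ne_zero, eq_comm, ← Int.cast_pow, ← hm, Int.cast_eq_zero] at hδ
    exact discr_ne_zero K hδ
  have h0 := hsq 0
  have h1 := hsq 1
  have h2 := hsq 2
  rw [abs_le] at h
  omega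

variable {K} in
-- The integers 1 and (1 + s)/2 span a lattice of discriminant -7, which is the field discriminant
-- times the square of the determinant over an integral basis.
lemma abs_discr_le_seven {s : K} (hs : s ^ 2 = -7) : |discr K| ≤ 7 := by
  obtain ⟨σ, -, hσσ, hfix, htr⟩ := exists_conjugation_of_isQuadraticExtension K
  obtain ⟨a, b, h, hspan⟩ := exists_integralBasis_of_isQuadraticExtension htr
  have hη : IsIntegral ℤ ((1 + s) / 2) := by
    refine ⟨Polynomial.X ^ 2 - Polynomial.X + 2, by monicity!, ?_⟩
    simp only [Polynomial.eval₂_add, Polynomial.eval₂_sub, Polynomial.eval₂_X_pow,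
      Polynomial.eval₂_X, Polynomial.eval₂_ofNat]
    linear_combination (1 / 4) * hs
  obtain ⟨m, n, h1⟩ := hspan 1
  obtain ⟨k, l, h2⟩ := hspan ⟨_, hη⟩
  have hσs : σ s = -s := by
    have : (σ s) ^ 2 = s ^ 2 := by rw [← map_pow, hs, map_neg, map_ofNat]
    refine (sq_eq_sq_iff_eq_or_eq_neg.mp this).resolve_left fun h ↦ ?_
    obtain ⟨q, rfl⟩ := hfix s h
    have : q ^ 2 = -7 := by exact_mod_cast hs
    nlinarith [sq_nonneg q]
  replace h2 : (1 + s) / 2 = k * a + l * b := h2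
  have h1' := congr_arg σ h1
  have h2' := congr_arg σ h2
  simp only [map_one, map_add, map_mul, map_intCast, map_div₀, map_ofNat, hσs] at h1 h1' h2'
  have hs' : -s = (m * l - n * k : ℤ) * ((a : K) * σ b - b * σ a) := by
    push_cast
    linear_combination (1 - s) / 2 * h1 + (m * a + n * b) * h2' - (1 + s) / 2 * h1' -
      (m * σ a + n * σ b) * h2
  have hj : -7 = (m * l - n * k) ^ 2 * discr K := by
    have : ((-7 : ℤ) : K) = (((m * l - n * k) ^ 2 * discr K : ℤ) : K) := by
      rw [Int.cast_mul, Int.cast_pow, h, ← mul_pow, ← hs', neg_sq, hs]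
      norm_num
    exact_mod_cast this
  have : |discr K| ∣ 7 := by
    rw [abs_dvd, ← dvd_neg, hj]
    exact dvd_mul_left _ _
  exact Int.le_of_dvd (by norm_num) this

end Conjugation

end NumberField

/-! ### Fields generated by √-7. -/

section Fields

variable {K : Type*} [Field K] [NumberField K] [Algebra.IsQuadraticExtension ℚ K] {s : K}

lemma ne_ratCast_of_sq_eq_neg_seven {L : Type*} [Field L] [CharZero L] {s : L} (hs : s ^ 2 = -7)
    (q : ℚ) : s ≠ q := by
  rintro rfl
  have : q ^ 2 = -7 := by exact_mod_cast hs
  nlinarith [sq_nonneg q]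

lemma minpoly_eq_of_sq_eq_neg_seven {L : Type*} [Field L] [CharZero L] [Algebra ℚ L] {s : L}
    (hs : s ^ 2 = -7) : minpoly ℚ s = Polynomial.X ^ 2 - Polynomial.C (-7) := by
  refine (minpoly.eq_of_irreducible_of_monic (X_pow_sub_C_irreducible_of_prime Nat.prime_two
    fun b hb ↦ ?_) ?_ (Polynomial.monic_X_pow_sub_C _ two_ne_zero)).symm
  · nlinarith [sq_nonneg b]
  · simp [hs]

lemma isIntegral_of_sq_eq_neg_seven {L : Type*} [Field L] [Algebra ℚ L] {s : L}
    (hs : s ^ 2 = -7) : IsIntegral ℚ s :=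
  ⟨Polynomial.X ^ 2 - Polynomial.C (-7), Polynomial.monic_X_pow_sub_C _ two_ne_zero, by simp [hs]⟩

lemma adjoin_eq_top_of_sq_eq_neg_seven (hs : s ^ 2 = -7) : ℚ⟮s⟯ = ⊤ := by
  have := IntermediateField.isSimpleOrder_of_finrank_prime ℚ K
    (by rw [Algebra.IsQuadraticExtension.finrank_eq_two]; exact Nat.prime_two)
  refine (eq_bot_or_eq_top _).resolve_left fun h ↦ ?_
  obtain ⟨q, hq⟩ := IntermediateField.mem_bot.mp (IntermediateField.adjoin_simple_eq_bot_iff.mp h)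
  exact ne_ratCast_of_sq_eq_neg_seven hs q (by rw [← hq, eq_ratCast])

lemma exists_algHom_of_sq_eq_neg_seven {L : Type*} [Field L] [CharZero L] [Algebra ℚ L] {z : L}
    (hs : s ^ 2 = -7) (hz : z ^ 2 = -7) : ∃ f : K →ₐ[ℚ] L, f s = z := by
  have hi := isIntegral_of_sq_eq_neg_seven hs
  have hroot : z ∈ (minpoly ℚ s).aroots L := by
    rw [minpoly_eq_of_sq_eq_neg_seven hs, ← minpoly_eq_of_sq_eq_neg_seven hz]
    exact Polynomial.mem_aroots.mpr
      ⟨minpoly.ne_zero (isIntegral_of_sq_eq_neg_seven hz), minpoly.aeval ℚ z⟩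
  let g := (IntermediateField.algHomAdjoinIntegralEquiv ℚ hi).symm ⟨z, hroot⟩
  let e : K ≃ₐ[ℚ] ℚ⟮s⟯ := IntermediateField.topEquiv.symm.trans
    (IntermediateField.equivOfEq (adjoin_eq_top_of_sq_eq_neg_seven hs).symm)
  refine ⟨g.comp e.toAlgHom, ?_⟩
  exact IntermediateField.algHomAdjoinIntegralEquiv_symm_apply_gen ℚ hi _

lemma sqrtNegSeven_sq : (Complex.I * (Real.sqrt 7 : ℂ)) ^ 2 = -7 := by
  rw [mul_pow, Complex.I_sq, ← Complex.ofReal_pow, Real.sq_sqrt (by norm_num)]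
  norm_num

lemma nonempty_ringEquiv_qSqrtNegSeven (hs : s ^ 2 = -7) : Nonempty (K ≃+* QSqrtNegSeven) := by
  obtain ⟨f, hf⟩ := exists_algHom_of_sq_eq_neg_seven hs sqrtNegSeven_sq
  have hrange : f.fieldRange = ℚ⟮Complex.I * (Real.sqrt 7 : ℂ)⟯ := by
    rw [AlgHom.fieldRange_eq_map, ← adjoin_eq_top_of_sq_eq_neg_seven hs,
      IntermediateField.adjoin_map, Set.image_singleton, hf]
  exact ⟨((AlgEquiv.ofInjectiveField f).trans (IntermediateField.equivOfEq hrange)).toRingEquiv⟩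

lemma finrank_qSqrtNegSeven : Module.finrank ℚ QSqrtNegSeven = 2 := by
  rw [IntermediateField.adjoin.finrank (isIntegral_of_sq_eq_neg_seven sqrtNegSeven_sq),
    minpoly_eq_of_sq_eq_neg_seven sqrtNegSeven_sq, Polynomial.natDegree_X_pow_sub_C]

instance numberField_qSqrtNegSeven : NumberField QSqrtNegSeven where
  to_finiteDimensional := Module.finite_of_finrank_eq_succ finrank_qSqrtNegSeven

lemma exists_sq_eq_neg_seven_of_ringEquiv {L : Type*} [Field L] (e : L ≃+* QSqrtNegSeven) :
    ∃ s : L, s ^ 2 = -7 := by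
  refine ⟨e.symm (IntermediateField.AdjoinSimple.gen ℚ _), ?_⟩
  rw [← map_pow, show IntermediateField.AdjoinSimple.gen ℚ (Complex.I * (Real.sqrt 7 : ℂ)) ^ 2 = -7
    from Subtype.ext sqrtNegSeven_sq, map_neg, map_ofNat]

lemma isQuadraticExtension_of_ringEquiv {L : Type*} [Field L] [Algebra ℚ L]
    (e : L ≃+* QSqrtNegSeven) : Algebra.IsQuadraticExtension ℚ L where
  finrank_eq_two' := by
    rw [← finrank_qSqrtNegSeven]
    exact Algebra.finrank_eq_of_equiv_equiv (RingEquiv.refl ℚ) e (Subsingleton.elim _ _)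

end Fields

/-! ### Assembling the two directions. -/

section Torsion

variable {K : Type*} [Field K] [NumberField K]

lemma not_appearsAsTorsionGroup_of_sq_eq {D : ℤ} (hD : D = -1 ∨ D = -3 ∨ D = 5) {δ : K}
    {σ : K →ₐ[ℚ] K} (hδ : δ ^ 2 = D) (hσ : σ δ = -δ) (hσσ : ∀ z, σ (σ z) = z)
    (hfix : ∀ z, σ z = z → ∃ q : ℚ, z = q) : ¬ AppearsAsTorsionGroup (ZMod 14) K := by
  classical
  rintro ⟨E, -, ⟨e⟩⟩
  have h1 : addOrderOf (1 : ZMod 14) = 14 := ZMod.addOrderOf_one 14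
  have h2 : addOrderOf (e.symm 1) = 14 :=
    (addOrderOf_injective e.symm.toAddMonoidHom e.symm.injective 1).trans h1
  rw [← AddSubgroup.addOrderOf_coe] at h2
  obtain ⟨x, y, hxy, h0, h4, h8⟩ :=
    WeierstrassCurve.Affine.exists_point_of_addOrderOf_eq two_ne_zero h2
  rcases WeierstrassCurve.Affine.x_eq_of_quadratic_field hD hδ hσ hσσ hfix hxy with h | h | h
  exacts [h0 h, h4 h, h8 h]

variable [Algebra.IsQuadraticExtension ℚ K]

lemma appearsAsTorsionGroup_of_sq_eq_neg_seven {s : K} (hs : s ^ 2 = -7) :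
    AppearsAsTorsionGroup (ZMod 14) K := by
  classical
  obtain ⟨z, hz⟩ := exists_sq_eq_neg_seven
  obtain ⟨f, -⟩ := exists_algHom_of_sq_eq_neg_seven hs hz
  exact ⟨WeierstrassCurve.curve14 s, WeierstrassCurve.Affine.isElliptic_curve14 hs,
    WeierstrassCurve.Affine.nonempty_torsion_curve14_equiv hs f.toRingHom⟩

/-- The discriminant of a quadratic field over which `ℤ/14ℤ` is a torsion group is at least `7` in
absolute value, with equality only if the field contains `√-7`. -/
lemma exists_sq_eq_neg_seven_of_appearsAsTorsionGroup (h : AppearsAsTorsionGroup (ZMod 14) K)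
    (hK : |NumberField.discr K| ≤ 7) : |NumberField.discr K| = 7 ∧ ∃ s : K, s ^ 2 = -7 := by
  obtain ⟨σ, -, hσσ, hfix, htr⟩ := NumberField.exists_conjugation_of_isQuadraticExtension K
  obtain ⟨δ, hδ, hσ, -⟩ := NumberField.exists_sq_eq_discr K hσσ hfix htr
  rcases NumberField.discr_eq_of_abs_le_seven K hK with h' | h' | h' | h' <;> rw [h'] at hδ ⊢
  · exact absurd h (not_appearsAsTorsionGroup_of_sq_eq (by norm_num) hδ hσ hσσ hfix)
  -- Discriminant -4 is ℚ(i), with i = δ/2.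
  · refine absurd h (not_appearsAsTorsionGroup_of_sq_eq (D := -1) (δ := δ / 2) (by norm_num) ?_ ?_
      hσσ hfix)
    · rw [div_pow, hδ]; norm_num
    · rw [map_div₀, hσ, map_ofNat]; ring
  · exact absurd h (not_appearsAsTorsionGroup_of_sq_eq (by norm_num) hδ hσ hσσ hfix)
  · exact ⟨rfl, δ, by rw [hδ]; norm_num⟩

end Torsion

theorem theorem4 (K : Type*) [Field K] [NumberField K] :
    IsSmallestQuadraticFieldWithTorsion (ZMod 14) K ↔ Nonempty (K ≃+* QSqrtNegSeven) := by
  constructor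
  · rintro ⟨hK, happ, hmin⟩
    -- Minimality quantifies over fields in the universe of `K`, so ℚ(√-7) is lifted there before
    -- being compared with it.
    let e : ULift QSqrtNegSeven ≃+* QSqrtNegSeven := ULift.ringEquiv
    have : NumberField (ULift QSqrtNegSeven) := NumberField.of_ringEquiv _ _ e.symm
    have hL := isQuadraticExtension_of_ringEquiv e
    obtain ⟨t, ht⟩ := exists_sq_eq_neg_seven_of_ringEquiv e
    have hle := (hmin (ULift QSqrtNegSeven) hL (appearsAsTorsionGroup_of_sq_eq_neg_seven ht)).trans
      (NumberField.abs_discr_le_seven ht)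
    obtain ⟨-, s, hs⟩ := exists_sq_eq_neg_seven_of_appearsAsTorsionGroup happ hle
    exact nonempty_ringEquiv_qSqrtNegSeven hs
  · rintro ⟨e⟩
    have hK := isQuadraticExtension_of_ringEquiv e
    obtain ⟨s, hs⟩ := exists_sq_eq_neg_seven_of_ringEquiv e
    have h7 := NumberField.abs_discr_le_seven hs
    refine ⟨hK, appearsAsTorsionGroup_of_sq_eq_neg_seven hs, fun L _ _ _ hL ↦ h7.trans ?_⟩
    by_contra! hlt
    exact hlt.ne (exists_sq_eq_neg_seven_of_appearsAsTorsionGroup hL hlt.le).1
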